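/- Let $r\ge 0$ and $n\ge 0$ be integers, and let $\mathcal C_n(r)$ be the Calogero–Moser space: the quotient by $GL_n(\mathbb C)$ of the set of quadruples $(X,Y;v,w)$ of complex matrices of sizes $n\times n$, $n\times n$, $n\times r$, $r\times n$ with $[X,Y]+vw=-I$, where $g(X,Y;v,w)=(gXg^{-1},gYg^{-1};gv,wg^{-1})$. Let $\mathcal C=\bigsqcup_{n\ge 0}\mathcal C_n(r)$. Let $\mathrm{Gr}^{rat}$ be the set of complex subspaces $W\subseteq\mathbb C(z)^r$ for which there are nonzero polynomials $p,q$ such that $p\,\mathbb C[z]^r\subseteq W\subseteq q^{-1}\mathbb C[z]^r$ and $W$ has codimension $r\deg q$ in $q^{-1}\mathbb C[z]^r$. For $R$ large let $H=L^2(\{|z|=R\},\mathbb C^r)$ (row vectors), let $H_+$ and $H_-$ be the subspaces of functions whose Fourier series involves only powers $z^k$ with $k\ge 0$, respectively $k<0$, and let $\overline W$ be the closure of $W$ in $H$. The reduced stationary Baker function of $W$ is the $r\times r$ matrix $\widetilde\psi_W(x,z)$, defined for those $x\in\mathbb C$ for which the projection $\overline We^{-xz}\to H_+$ along $H_-$ is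 an isomorphism, whose $i$-th row is the inverse image of the $i$-th basis vector under this projection (for all sufficiently large $R$). We say that $W=\beta(X,Y;v,w)$ if $W\in\mathrm{Gr}^{rat}$ and, for every $x$ with $\det(xI+X)\neq 0$, the reduced stationary Baker function of $W$ at $x$ is defined and $$\widetilde\psi_W(x,z)=I+w\,(xI+X)^{-1}(zI-Y)^{-1}v .$$ Let $\beta(\mathcal C)$ be the set of all $W$ such that $W=\beta(X,Y;v,w)$ for some $n\ge 0$ and some point of $\mathcal C_n(r)$. For $W\in\mathrm{Gr}^{rat}$ let $\mathcal D(\mathbb C[z],W)$ be the set of operators $D=(D_1,\dots,D_r)\in\mathbb C(z)[\partial_z]^r$ such that $(D_1.p,\dots,D_r.p)\in W$ for every polynomial $p\in\mathbb C[z]$. Write $D=\sum_{k=0}^m d_k\partial_z^k$ with $d_k\in\mathbb C(z)^r$ and $d_m\ne 0$; its leading coefficient is $d_m$ (and $0$ if $D=0$). Let $L_W\subseteq\mathbb C(z)^r$ be the set of leading coefficients of all $D\in\mathcal D(\mathbb C[z],W)$. **Proposition.** If $W\in\beta(\mathcal C)\subset\mathrm{Gr}^{rat}$, then $L_W=\mathbb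 C[z]^r$. -/

import Mathlib

open Polynomial MeasureTheory Filter

noncomputable section

/-! ### The Calogero-Moser spaces -/

/-- The points of `μ⁻¹(-I)`: quadruples `(X, Y; v, w)` with `[X, Y] + v w = -I`. -/
@[ext]
structure CMQuadruple (n r : ℕ) where
  X : Matrix (Fin n) (Fin n) ℂ
  Y : Matrix (Fin n) (Fin n) ℂ
  v : Matrix (Fin n) (Fin r) ℂ
  w : Matrix (Fin r) (Fin n) ℂ
  moment : X * Y - Y * X + v * w = -1

namespace CMQuadruple

variable {n r : ℕ}

/-- `g (X, Y; v, w) = (g X g⁻¹, g Y g⁻¹; g v, w g⁻¹)`. -/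
instance : SMul (GL (Fin n) ℂ) (CMQuadruple n r) where
  smul g q :=
    { X := (g : Matrix (Fin n) (Fin n) ℂ) * q.X * ((g⁻¹ : GL (Fin n) ℂ) : Matrix (Fin n) (Fin n) ℂ)
      Y := (g : Matrix (Fin n) (Fin n) ℂ) * q.Y * ((g⁻¹ : GL (Fin n) ℂ) : Matrix (Fin n) (Fin n) ℂ)
      v := (g : Matrix (Fin n) (Fin n) ℂ) * q.v
      w := q.w * ((g⁻¹ : GL (Fin n) ℂ) : Matrix (Fin n) (Fin n) ℂ)
      moment := by
        have h1 : ((g⁻¹ : GL (Fin n) ℂ) : Matrix (Fin n) (Fin n) ℂ) *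
            (g : Matrix (Fin n) (Fin n) ℂ) = 1 := Units.inv_mul g
        have h2 : (g : Matrix (Fin n) (Fin n) ℂ) *
            ((g⁻¹ : GL (Fin n) ℂ) : Matrix (Fin n) (Fin n) ℂ) = 1 := Units.mul_inv g
        generalize ((g⁻¹ : GL (Fin n) ℂ) : Matrix (Fin n) (Fin n) ℂ) = k at *
        generalize (g : Matrix (Fin n) (Fin n) ℂ) = a at *
        have e : ∀ A B : Matrix (Fin n) (Fin n) ℂ,
            a * A * k * (a * B * k) = a * (A * B) * k := fun A B => by
          calc a * A * k * (a * B * k) = a * A * (k * a) * B * k := by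
                simp only [Matrix.mul_assoc]
            _ = a * (A * B) * k := by rw [h1]; simp only [Matrix.mul_assoc, Matrix.one_mul]
        have e' : a * q.v * (q.w * k) = a * (q.v * q.w) * k := by
          simp only [Matrix.mul_assoc]
        rw [e, e, e', ← Matrix.sub_mul, ← Matrix.mul_sub, ← Matrix.add_mul, ← Matrix.mul_add,
          q.moment, Matrix.mul_neg, Matrix.neg_mul, Matrix.mul_one, h2] }

theorem smul_X (g : GL (Fin n) ℂ) (q : CMQuadruple n r) :
    (g • q).X = (g : Matrix (Fin n) (Fin n) ℂ) * q.X * ((g⁻¹ : GL (Fin n) ℂ) : Matrix (Fin n) (Fin n) ℂ) := rfl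

theorem smul_Y (g : GL (Fin n) ℂ) (q : CMQuadruple n r) :
    (g • q).Y = (g : Matrix (Fin n) (Fin n) ℂ) * q.Y * ((g⁻¹ : GL (Fin n) ℂ) : Matrix (Fin n) (Fin n) ℂ) := rfl

theorem smul_v (g : GL (Fin n) ℂ) (q : CMQuadruple n r) :
    (g • q).v = (g : Matrix (Fin n) (Fin n) ℂ) * q.v := rfl

theorem smul_w (g : GL (Fin n) ℂ) (q : CMQuadruple n r) :
    (g • q).w = q.w * ((g⁻¹ : GL (Fin n) ℂ) : Matrix (Fin n) (Fin n) ℂ) := rfl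

instance : MulAction (GL (Fin n) ℂ) (CMQuadruple n r) where
  one_smul q := by
    ext1 <;> simp [smul_X, smul_Y, smul_v, smul_w]
  mul_smul g h q := by
    ext1 <;> simp only [smul_X, smul_Y, smul_v, smul_w, _root_.mul_inv_rev, Units.val_mul,
      Matrix.mul_assoc]

/-- `det (x I + X)`. -/
def poleDet (q : CMQuadruple n r) (x : ℂ) : ℂ :=
  (x • (1 : Matrix (Fin n) (Fin n) ℂ) + q.X).det

/-- `I + w (x I + X)⁻¹ (z I - Y)⁻¹ v`. -/
def bakerFormula (q : CMQuadruple n r) (x z : ℂ) : Matrix (Fin r) (Fin r) ℂ :=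
  1 + q.w * (x • (1 : Matrix (Fin n) (Fin n) ℂ) + q.X)⁻¹ *
    (z • (1 : Matrix (Fin n) (Fin n) ℂ) - q.Y)⁻¹ * q.v

theorem conj_add (g : GL (Fin n) ℂ) (A : Matrix (Fin n) (Fin n) ℂ) (x : ℂ) :
    x • (1 : Matrix (Fin n) (Fin n) ℂ) +
        (g : Matrix (Fin n) (Fin n) ℂ) * A * ((g⁻¹ : GL (Fin n) ℂ) : Matrix (Fin n) (Fin n) ℂ) =
      (g : Matrix (Fin n) (Fin n) ℂ) * (x • (1 : Matrix (Fin n) (Fin n) ℂ) + A) *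
        ((g⁻¹ : GL (Fin n) ℂ) : Matrix (Fin n) (Fin n) ℂ) := by
  have h2 : (g : Matrix (Fin n) (Fin n) ℂ) *
      ((g⁻¹ : GL (Fin n) ℂ) : Matrix (Fin n) (Fin n) ℂ) = 1 := Units.mul_inv g
  rw [Matrix.mul_add, Matrix.add_mul, Matrix.mul_smul, Matrix.mul_one, Matrix.smul_mul, h2]

theorem conj_inv (g : GL (Fin n) ℂ) (A : Matrix (Fin n) (Fin n) ℂ) :
    ((g : Matrix (Fin n) (Fin n) ℂ) * A * ((g⁻¹ : GL (Fin n) ℂ) : Matrix (Fin n) (Fin n) ℂ))⁻¹ =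
      (g : Matrix (Fin n) (Fin n) ℂ) * A⁻¹ * ((g⁻¹ : GL (Fin n) ℂ) : Matrix (Fin n) (Fin n) ℂ) := by
  rw [Matrix.mul_inv_rev, Matrix.mul_inv_rev, ← Matrix.coe_units_inv, ← Matrix.coe_units_inv,
    inv_inv, Matrix.mul_assoc]

theorem poleDet_smul (g : GL (Fin n) ℂ) (q : CMQuadruple n r) :
    poleDet (g • q) = poleDet q := by
  funext x
  have h2 : (g : Matrix (Fin n) (Fin n) ℂ).det *
      ((g⁻¹ : GL (Fin n) ℂ) : Matrix (Fin n) (Fin n) ℂ).det = 1 := by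
    rw [← Matrix.det_mul, Units.mul_inv, Matrix.det_one]
  rw [poleDet, poleDet, smul_X, conj_add, Matrix.det_mul, Matrix.det_mul, mul_right_comm, h2,
    one_mul]

theorem bakerFormula_smul (g : GL (Fin n) ℂ) (q : CMQuadruple n r) :
    bakerFormula (g • q) = bakerFormula q := by
  funext x z
  have h1 : ((g⁻¹ : GL (Fin n) ℂ) : Matrix (Fin n) (Fin n) ℂ) *
      (g : Matrix (Fin n) (Fin n) ℂ) = 1 := Units.inv_mul g
  have hY : z • (1 : Matrix (Fin n) (Fin n) ℂ) - (g : Matrix (Fin n) (Fin n) ℂ) * q.Y *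
        ((g⁻¹ : GL (Fin n) ℂ) : Matrix (Fin n) (Fin n) ℂ) =
      (g : Matrix (Fin n) (Fin n) ℂ) * (z • (1 : Matrix (Fin n) (Fin n) ℂ) - q.Y) *
        ((g⁻¹ : GL (Fin n) ℂ) : Matrix (Fin n) (Fin n) ℂ) := by
    simpa [sub_eq_add_neg] using conj_add g (-q.Y) z
  rw [bakerFormula, bakerFormula, smul_X, smul_Y, smul_v, smul_w, conj_add, hY, conj_inv,
    conj_inv]
  generalize ((g⁻¹ : GL (Fin n) ℂ) : Matrix (Fin n) (Fin n) ℂ) = k at *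
  generalize (g : Matrix (Fin n) (Fin n) ℂ) = a at *
  have e : ∀ (s : ℕ) (M : Matrix (Fin n) (Fin s) ℂ), k * (a * M) = M := fun s M => by
    rw [← Matrix.mul_assoc, h1, Matrix.one_mul]
  simp only [Matrix.mul_assoc, e]

end CMQuadruple

/-- The Calogero-Moser space `𝒞_n(r) = μ⁻¹(-I) / GL_n(ℂ)`. -/
abbrev CMSpace (n r : ℕ) : Type :=
  Quotient (MulAction.orbitRel (GL (Fin n) ℂ) (CMQuadruple n r))

/-- `det (x I + X)` on the Calogero-Moser space. -/
def CMSpace.poleDet {n r : ℕ} : CMSpace n r → ℂ → ℂ :=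
  Quotient.lift CMQuadruple.poleDet (by
    rintro _ q ⟨g, rfl⟩
    exact CMQuadruple.poleDet_smul g q)

/-- `I + w (x I + X)⁻¹ (z I - Y)⁻¹ v` on the Calogero-Moser space. -/
def CMSpace.bakerFormula {n r : ℕ} : CMSpace n r → ℂ → ℂ → Matrix (Fin r) (Fin r) ℂ :=
  Quotient.lift CMQuadruple.bakerFormula (by
    rintro _ q ⟨g, rfl⟩
    exact CMQuadruple.bakerFormula_smul g q)

/-! ### The rational Grassmannian -/

/-- `ℂ(z)^r`, as row vectors. -/
abbrev RatVec (r : ℕ) : Type := Fin r → RatFunc ℂ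

/-- The lattice `ℂ[z]^r` in `ℂ(z)^r`. -/
def baseLattice (r : ℕ) : Submodule ℂ[X] (RatVec r) :=
  Submodule.pi Set.univ fun _ => LinearMap.range (Algebra.linearMap ℂ[X] (RatFunc ℂ))

/-- The complex subspace `c ℂ[z]^r` of `ℂ(z)^r`, for a rational function `c`. -/
def scaledBase (r : ℕ) (c : RatFunc ℂ) : Submodule ℂ (RatVec r) :=
  ((baseLattice r).restrictScalars ℂ).map (Algebra.lsmul ℂ ℂ (RatVec r) c)

/-- `Gr^rat(r)`: the subspaces `W` with `p ℂ[z]^r ⊆ W ⊆ q⁻¹ ℂ[z]^r` for some nonzero polynomials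
`p`, `q`, such that `W` has codimension `r deg q` in `q⁻¹ ℂ[z]^r`. (The codimension is finite
because of the first inclusion.) -/
def GrRat (r : ℕ) : Set (Submodule ℂ (RatVec r)) :=
  {W | ∃ p q : ℂ[X], p ≠ 0 ∧ q ≠ 0 ∧
    scaledBase r (algebraMap ℂ[X] (RatFunc ℂ) p) ≤ W ∧
    W ≤ scaledBase r (algebraMap ℂ[X] (RatFunc ℂ) q)⁻¹ ∧
    Module.finrank ℂ (↥(scaledBase r (algebraMap ℂ[X] (RatFunc ℂ) q)⁻¹) ⧸
      W.comap (scaledBase r (algebraMap ℂ[X] (RatFunc ℂ) q)⁻¹).subtype) = r * q.natDegree}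

/-! ### The restricted Grassmannian of a circle and Baker functions -/

/-- The Hilbert space `H` of square integrable `ℂ^r`-valued functions on a circle `|z| = R`,
where the circle is parametrised by `t ↦ R exp (2 π i t)`. -/
abbrev CircleL2 (r : ℕ) : Type :=
  Lp (EuclideanSpace ℂ (Fin r)) 2 (AddCircle.haarAddCircle (T := (1 : ℝ)))

/-- The point `R exp (2 π i t)` of the circle `|z| = R`. -/
def circlePoint (R : ℝ) (t : UnitAddCircle) : ℂ := (R : ℂ) * (AddCircle.toCircle t : ℂ)

/-- The subspace `H₊`: no negative powers of `z`. -/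
def InHPlus {r : ℕ} (f : UnitAddCircle → EuclideanSpace ℂ (Fin r)) : Prop :=
  ∀ k : ℤ, k < 0 → fourierCoeff f k = 0

/-- The subspace `H₋`: only negative powers of `z`. -/
def InHMinus {r : ℕ} (f : UnitAddCircle → EuclideanSpace ℂ (Fin r)) : Prop :=
  ∀ k : ℤ, 0 ≤ k → fourierCoeff f k = 0

/-- The closure of `W` in the space `H` of the circle `|z| = R`. -/
def circleClosure {r : ℕ} (W : Submodule ℂ (RatVec r)) (R : ℝ) : Set (CircleL2 r) :=
  closure {F | ∃ f ∈ W, ∀ᵐ t ∂(AddCircle.haarAddCircle (T := (1 : ℝ))),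
    F t = WithLp.toLp 2 fun i => (f i).eval (RingHom.id ℂ) (circlePoint R t)}

/-- The translate `S g⁻¹` of a subset `S` of `H` by the inverse of a loop `g`
acting on row vectors on the right: all `F` such that `F g` belongs to `S`. -/
def translateInv {r : ℕ} (S : Set (CircleL2 r)) (R : ℝ) (g : ℂ → Matrix (Fin r) (Fin r) ℂ) :
    Set (CircleL2 r) :=
  {F | ∃ G ∈ S, ∀ᵐ t ∂(AddCircle.haarAddCircle (T := (1 : ℝ))),
    G t = WithLp.toLp 2 (Matrix.vecMul (WithLp.ofLp (F t)) (g (circlePoint R t)))}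

/-- `S` belongs to the big cell: the projection `S → H₊` along `H₋` is bijective. -/
def InBigCell {r : ℕ} (S : Set (CircleL2 r)) : Prop :=
  ∀ G : CircleL2 r, InHPlus G → ∃! F : CircleL2 r, F ∈ S ∧ InHMinus ⇑(F - G)

/-- `P` is the reduced Baker function of `W` at the loop `g`, on all sufficiently large circles:
`W g⁻¹` is in the big cell and the `i`-th row of `P` is the inverse image of the
`i`-th basis vector under the projection `W g⁻¹ → H₊`. That is, `P` has the form `I + O(z⁻¹)` and
the rows of `P g` belong to (the closure of) `W`. -/
def IsReducedBakerAt {r : ℕ} (W : Submodule ℂ (RatVec r)) (g P : ℂ → Matrix (Fin r) (Fin r) ℂ) :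
    Prop :=
  ∀ᶠ R : ℝ in atTop,
    InBigCell (translateInv (circleClosure W R) R g) ∧
    ∀ i : Fin r, ∃ F ∈ translateInv (circleClosure W R) R g,
      (∀ᵐ t ∂(AddCircle.haarAddCircle (T := (1 : ℝ))),
        F t = WithLp.toLp 2 ((P (circlePoint R t)) i)) ∧
      InHMinus fun t => F t - EuclideanSpace.single i (1 : ℂ)

/-- The element `z ↦ exp (x z) I` of the one-parameter group of the stationary flow. -/
def stationaryLoop (r : ℕ) (x z : ℂ) : Matrix (Fin r) (Fin r) ℂ :=
  Complex.exp (x * z) • (1 : Matrix (Fin r) (Fin r) ℂ)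

/-! ### The map `β` -/

/-- `W = β(c)`: the space `W` is the point of `Gr^rat` whose reduced stationary Baker function is
`I + w (x I + X)⁻¹ (z I - Y)⁻¹ v`, wherever this is defined. -/
def IsBeta {n r : ℕ} (c : CMSpace n r) (W : Submodule ℂ (RatVec r)) : Prop :=
  W ∈ GrRat r ∧ ∀ x : ℂ, c.poleDet x ≠ 0 →
    IsReducedBakerAt W (stationaryLoop r x) (c.bakerFormula x)

/-- The image of `β` on the disjoint union of the spaces `𝒞_n(r)`, `n ≥ 0`. -/
def betaImage (r : ℕ) : Set (Submodule ℂ (RatVec r)) :=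
  {W | ∃ (n : ℕ) (c : CMSpace n r), IsBeta c W}

/-! ### Differential operators and the lattice of leading coefficients -/

/-- `ℂ(z)[∂_z]^r`: the finitely supported `D` stands for the operator `∑ D k ∂_z^k`, with
coefficients `D k` in `ℂ(z)^r`. -/
abbrev VecDiffOp (r : ℕ) : Type := ℕ →₀ RatVec r

/-- The action `D.p = (D₁.p, …, D_r.p)` of an operator on a polynomial `p`. -/
def VecDiffOp.act {r : ℕ} (D : VecDiffOp r) (p : ℂ[X]) : RatVec r :=
  D.sum fun k d i => d i * algebraMap ℂ[X] (RatFunc ℂ) (derivative^[k] p)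

/-- The leading coefficient of `D`: its coefficient at the highest power of `∂_z` that occurs
(and `0` for `D = 0`). -/
def VecDiffOp.leadingCoeff {r : ℕ} (D : VecDiffOp r) : RatVec r := D (D.support.sup id)

/-- `𝒟(ℂ[z], W)`: the operators that map `ℂ[z]` into `W`. -/
def diffOpsInto {r : ℕ} (W : Submodule ℂ (RatVec r)) : Set (VecDiffOp r) :=
  {D | ∀ p : ℂ[X], D.act p ∈ W}

/-- `L_W`: the leading coefficients of the operators in `𝒟(ℂ[z], W)`. -/
def leadingLattice {r : ℕ} (W : Submodule ℂ (RatVec r)) : Set (RatVec r) :=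
  VecDiffOp.leadingCoeff '' diffOpsInto W

end

/-! Put τ(x) = det(xI + X), monic of degree n. Multiplied by τ, the i-th row of the Baker function
becomes a polynomial in x, S_i(x, z) = τ(x) e_i + (terms of degree < n in x whose coefficients
vanish at z = ∞). Reading x as ∂_z makes S_i an operator of order n with leading coefficient e_i;
`BakerSystem` records these properties.

The S_i belong to 𝒟(ℂ[z], W). Indeed S_i(∂_z) sends e^{xz} to S_i(x, z) e^{xz}, which lies in the
closure of W whenever τ(x) ≠ 0. Its expansion in powers of x has the coefficients S_i(∂_z).z^j / j!,
so the identity theorem puts each S_i(∂_z).z^j in the closure of W (`mapsInto_of_eventually_mem`),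
and a rational vector in that closure is already in W (`mem_of_circleClass_mem`).

ℂ[z]^r ⊆ L_W: 𝒟(ℂ[z], W) is stable under composition on the right with polynomial differential
operators, and Σ S_i ∘ g_i has leading coefficient (g_1, …, g_r).

L_W ⊆ ℂ[z]^r (`BakerSystem.coeff_mem_range`): induction on J, where the coefficients of V are o(z^J)
at infinity. For J = 0, V(x, z) e^{xz} is in the closure of W and V(x, z) is in H₋, so the
injectivity of the projection to H₊ gives V(x, z) = 0 for all but finitely many x, hence V = 0
(`eq_zero_of_mapsInto`). For J + 1, write V = Σ_j c_j(∂) z^J e_j + o(z^J) on symbols, with c_j of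
constant coefficients. The operator with symbol τV − Σ_j c_j · symbol(S_j ∘ z^J) again maps ℂ[z]
into W and is o(z^J). Its top coefficient is that of V minus a polynomial vector, so induction
applies. -/

noncomputable section

/-! ### Symbols of differential operators -/

/-- The action of the differential operator with symbol `P`, the variable of `P` standing for
`∂_z`, on a polynomial. -/
def opAct (P : (RatFunc ℂ)[X]) (p : ℂ[X]) : RatFunc ℂ :=
  P.sum fun k d => d * algebraMap ℂ[X] (RatFunc ℂ) (derivative^[k] p)

theorem opAct_monomial (k : ℕ) (d : RatFunc ℂ) (p : ℂ[X]) :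
    opAct (monomial k d) p = d * algebraMap ℂ[X] (RatFunc ℂ) (derivative^[k] p) :=
  sum_monomial_index _ _ (zero_mul _)

theorem opAct_add (P Q : (RatFunc ℂ)[X]) (p : ℂ[X]) :
    opAct (P + Q) p = opAct P p + opAct Q p :=
  sum_add_index _ _ _ (fun _ => zero_mul _) fun _ _ _ => add_mul _ _ _

theorem opAct_zero (p : ℂ[X]) : opAct 0 p = 0 := sum_zero_index _

theorem opAct_C_mul (a : RatFunc ℂ) (P : (RatFunc ℂ)[X]) (p : ℂ[X]) :
    opAct (C a * P) p = a * opAct P p := by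
  induction P using Polynomial.induction_on' with
  | add P Q hP hQ => rw [mul_add, opAct_add, opAct_add, hP, hQ, mul_add]
  | monomial k d => rw [C_mul_monomial, opAct_monomial, opAct_monomial, mul_assoc]

/-- Coefficients stand to the left of ∂, so multiplying a symbol by the variable composes the
operator with ∂ on the right. That is the side on which operators into W can be composed, W being
only a complex subspace. -/
theorem opAct_X_mul (P : (RatFunc ℂ)[X]) (p : ℂ[X]) :
    opAct (X * P) p = opAct P (derivative p) := by
  induction P using Polynomial.induction_on' with
  | add P Q hP hQ => rw [mul_add, opAct_add, opAct_add, hP, hQ]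
  | monomial k d =>
    rw [X_mul_monomial, opAct_monomial, opAct_monomial, Function.iterate_succ_apply]

/-- The commutator [∂^k, z] = k ∂^(k-1); at k = 0 the truncated exponent is harmless because of the
factor k. -/
theorem iterate_derivative_X_mul' (k : ℕ) (p : ℂ[X]) :
    derivative^[k] (X * p) = X * derivative^[k] p + (k : ℂ[X]) * derivative^[k - 1] p := by
  rw [mul_comm, iterate_derivative_mul_X, nsmul_eq_mul, mul_comm]

/-- The symbol of the composition of the operator with symbol `P` with multiplication by `z`. -/
def mulZ (P : (RatFunc ℂ)[X]) : (RatFunc ℂ)[X] := derivative P + C RatFunc.X * P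

theorem opAct_mulZ (P : (RatFunc ℂ)[X]) (p : ℂ[X]) :
    opAct (mulZ P) p = opAct P (X * p) := by
  unfold mulZ
  rw [opAct_add, opAct_C_mul]
  induction P using Polynomial.induction_on' with
  | add P Q hP hQ =>
    rw [derivative_add, opAct_add, opAct_add, opAct_add, ← hP, ← hQ]
    ring
  | monomial k d =>
    rw [derivative_monomial, opAct_monomial, opAct_monomial, opAct_monomial,
      iterate_derivative_X_mul', map_add, map_mul, map_mul, RatFunc.algebraMap_X, map_natCast]
    ring

/-- Used to see that composition with z does not raise the order and multiplies the top coefficient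
by z. -/
theorem coeff_mulZ (P : (RatFunc ℂ)[X]) (k : ℕ) :
    (mulZ P).coeff k = P.coeff (k + 1) * ((k : RatFunc ℂ) + 1) + RatFunc.X * P.coeff k := by
  rw [mulZ, coeff_add, coeff_derivative, coeff_C_mul]

/-- The operators `P` that map `ℂ[z]` into `W`. -/
def MapsInto {r : ℕ} (W : Submodule ℂ (RatVec r)) (P : Fin r → (RatFunc ℂ)[X]) : Prop :=
  ∀ p : ℂ[X], (fun i => opAct (P i) p) ∈ W

namespace MapsInto

variable {r : ℕ} {W : Submodule ℂ (RatVec r)} {P Q : Fin r → (RatFunc ℂ)[X]}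

theorem zero : MapsInto W 0 := fun p => by
  simp only [Pi.zero_apply, opAct_zero]
  exact W.zero_mem

theorem add (hP : MapsInto W P) (hQ : MapsInto W Q) : MapsInto W (P + Q) := fun p => by
  simp only [Pi.add_apply, opAct_add]
  exact W.add_mem (hP p) (hQ p)

theorem const_mul (a : ℂ) (hP : MapsInto W P) :
    MapsInto W fun i => C (algebraMap ℂ (RatFunc ℂ) a) * P i := fun p => by
  have := W.smul_mem a (hP p)
  convert this using 2 with i
  rw [opAct_C_mul, ← Algebra.smul_def]
  rfl

theorem X_mul (hP : MapsInto W P) : MapsInto W fun i => X * P i := fun p => by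
  simpa only [opAct_X_mul] using hP (derivative p)

theorem mulZ (hP : MapsInto W P) : MapsInto W fun i => _root_.mulZ (P i) := fun p => by
  simpa only [opAct_mulZ] using hP (X * p)

theorem map_mul (hP : MapsInto W P) (c : ℂ[X]) :
    MapsInto W fun i => c.map (algebraMap ℂ (RatFunc ℂ)) * P i := by
  induction c using Polynomial.induction_on with
  | C a => simpa only [map_C] using hP.const_mul a
  | add p q hp hq =>
    simp only [Polynomial.map_add, add_mul]
    exact hp.add hq
  | monomial n a h =>
    convert h.X_mul using 2 with i
    simp only [Polynomial.map_mul, Polynomial.map_pow, map_X, pow_succ]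
    ring

theorem sum {ι : Type*} (s : Finset ι) (F : ι → Fin r → (RatFunc ℂ)[X])
    (h : ∀ j ∈ s, MapsInto W (F j)) : MapsInto W fun i => ∑ j ∈ s, F j i := by
  classical
  induction s using Finset.induction_on with
  | empty => exact zero
  | insert a s ha ih =>
    simp only [Finset.sum_insert ha]
    exact (h a (Finset.mem_insert_self _ _)).add
      (ih fun j hj => h j (Finset.mem_insert_of_mem hj))

theorem neg (hP : MapsInto W P) : MapsInto W fun i => -P i := by
  simpa using hP.const_mul (-1)

theorem iterate_mulZ (hP : MapsInto W P) (J : ℕ) :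
    MapsInto W fun i => _root_.mulZ^[J] (P i) := by
  induction J with
  | zero => exact hP
  | succ J ih => simpa only [Function.iterate_succ_apply'] using ih.mulZ

/-- Composition with multiplication by a polynomial `g`. -/
theorem exists_comp_mul {n : ℕ} (hP : MapsInto W P) (hd : ∀ i k, n < k → (P i).coeff k = 0)
    (g : ℂ[X]) : ∃ Q, MapsInto W Q ∧ (∀ i k, n < k → (Q i).coeff k = 0) ∧
      ∀ i, (Q i).coeff n = algebraMap ℂ[X] (RatFunc ℂ) g * (P i).coeff n := by
  induction g using Polynomial.induction_on with
  | C a =>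
    refine ⟨_, hP.const_mul a, fun i k hk => ?_, fun i => ?_⟩
    · rw [coeff_C_mul, hd i k hk, mul_zero]
    · rw [coeff_C_mul]; rfl
  | add p q hp hq =>
    obtain ⟨A, hA, hA', hA''⟩ := hp
    obtain ⟨B, hB, hB', hB''⟩ := hq
    refine ⟨_, hA.add hB, fun i k hk => ?_, fun i => ?_⟩
    · simp [hA' i k hk, hB' i k hk]
    · simp only [Pi.add_apply, coeff_add, hA'', hB'']
      rw [_root_.map_add, add_mul]
  | monomial j a h =>
    obtain ⟨A, hA, hA', hA''⟩ := h
    refine ⟨_, hA.mulZ, fun i k hk => ?_, fun i => ?_⟩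
    · rw [coeff_mulZ, hA' i k hk, hA' i (k + 1) (by omega)]; simp
    · rw [coeff_mulZ, hA' i (n + 1) (by omega), hA'', pow_succ]
      simp only [_root_.map_mul, RatFunc.algebraMap_X]
      ring

end MapsInto

/-! ### The filtration by the order of growth at infinity -/

/-- The valuation of `ℂ(z)` at infinity. -/
def infVal : Valuation (RatFunc ℂ) (WithZero (Multiplicative ℤ)) := by
  classical exact RatFunc.inftyValuation ℂ

theorem infVal_X : infVal RatFunc.X = WithZero.exp 1 := by
  classical exact RatFunc.inftyValuation.X ℂ

theorem infVal_polynomial {p : ℂ[X]} (hp : p ≠ 0) :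
    infVal (algebraMap ℂ[X] (RatFunc ℂ) p) = WithZero.exp (p.natDegree : ℤ) := by
  classical exact RatFunc.inftyValuation.polynomial ℂ hp

theorem infVal_const_le (a : ℂ) : infVal (algebraMap ℂ (RatFunc ℂ) a) ≤ 1 := by
  by_cases ha : a = 0
  · simp [ha]
  · classical exact (RatFunc.inftyValuation.C ℂ ha).le

theorem mul_denom_eq_num (f : RatFunc ℂ) :
    f * algebraMap ℂ[X] (RatFunc ℂ) f.denom = algebraMap ℂ[X] (RatFunc ℂ) f.num := by
  conv_lhs => lhs; rw [← f.num_div_denom]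
  exact div_mul_cancel₀ _ (by simpa using f.denom_ne_zero)

/-- Two polynomials `a`, `b` with `deg a < deg b + J` have a quotient growing slower than `z^J`. -/
theorem infVal_lt_of_degree {f : RatFunc ℂ} {a b : ℂ[X]} (hb : b ≠ 0) {J : ℕ}
    (h : f * algebraMap ℂ[X] (RatFunc ℂ) b = algebraMap ℂ[X] (RatFunc ℂ) a)
    (hd : a.degree < b.degree + J) : infVal f < WithZero.exp (J : ℤ) := by
  have hb' := infVal_polynomial hb
  have h' := congrArg infVal h
  rw [map_mul, hb'] at h'
  by_cases ha : a = 0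
  · have hf : f = 0 := by
      rw [ha, map_zero] at h
      exact (mul_eq_zero.mp h).resolve_right (by simpa using hb)
    rw [hf, map_zero]
    exact WithZero.exp_pos
  · rw [infVal_polynomial ha] at h'
    rw [degree_eq_natDegree ha, degree_eq_natDegree hb] at hd
    have hd' : (a.natDegree : ℤ) < b.natDegree + J := by exact_mod_cast hd
    have : infVal f = WithZero.exp ((a.natDegree : ℤ) - b.natDegree) := by
      rw [WithZero.exp_sub, eq_div_iff WithZero.exp_ne_zero, h']
    rw [this, WithZero.exp_lt_exp]
    omega

theorem degree_lt_of_infVal_lt {f : RatFunc ℂ} {J : ℕ} (hf : infVal f < WithZero.exp (J : ℤ)) :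
    f.num.degree < f.denom.degree + J := by
  have hb := f.denom_ne_zero
  by_cases ha : f.num = 0
  · rw [ha, degree_zero, degree_eq_natDegree hb]
    exact_mod_cast WithBot.bot_lt_coe _
  · rw [← f.num_div_denom, map_div₀, infVal_polynomial ha, infVal_polynomial hb,
      ← WithZero.exp_sub, WithZero.exp_lt_exp] at hf
    rw [degree_eq_natDegree ha, degree_eq_natDegree hb]
    have : f.num.natDegree < f.denom.natDegree + J := by omega
    exact_mod_cast this

/-- Every rational function growing slower than `z^(J+1)` is a multiple of `z^J` up to terms
growing slower than `z^J`. -/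
theorem exists_infVal_sub_lt {f : RatFunc ℂ} {J : ℕ}
    (hf : infVal f < WithZero.exp ((J + 1 : ℕ) : ℤ)) :
    ∃ c : ℂ, infVal (f - algebraMap ℂ (RatFunc ℂ) c * RatFunc.X ^ J) < WithZero.exp (J : ℤ) := by
  have hb := f.denom_ne_zero
  have hd := degree_lt_of_infVal_lt hf
  have hm := f.monic_denom
  set d := f.denom.natDegree with hd'
  have hdeg : f.num.natDegree ≤ d + J := by
    by_cases ha : f.num = 0
    · simp [ha]
    rw [degree_eq_natDegree ha, degree_eq_natDegree hb] at hd
    have : f.num.natDegree < f.denom.natDegree + (J + 1 : ℕ) := by exact_mod_cast hd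
    omega
  refine ⟨f.num.coeff (d + J), infVal_lt_of_degree (b := f.denom)
    (a := f.num - C (f.num.coeff (d + J)) * X ^ J * f.denom) hb ?_ ?_⟩
  · rw [sub_mul, map_sub]
    rw [mul_denom_eq_num, map_mul, map_mul, map_pow, RatFunc.algebraMap_X]
    rfl
  · rw [degree_eq_natDegree hb, ← hd']
    have : ((d : WithBot ℕ) + J) = ((d + J : ℕ) : WithBot ℕ) := by push_cast; rfl
    rw [this, degree_lt_iff_coeff_zero]
    intro m hm'
    rw [coeff_sub, mul_assoc, coeff_C_mul, coeff_X_pow_mul', if_pos (by omega)]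
    rcases hm'.eq_or_lt with h | h
    · rw [← h, Nat.add_sub_cancel, hd', hm.coeff_natDegree]; ring
    · rw [coeff_eq_zero_of_natDegree_lt (by omega),
        coeff_eq_zero_of_natDegree_lt (p := f.denom) (by omega)]; ring

theorem exists_infVal_lt (f : RatFunc ℂ) : ∃ J : ℕ, infVal f < WithZero.exp (J : ℤ) := by
  by_cases hf : f = 0
  · exact ⟨0, by rw [hf, map_zero]; exact WithZero.exp_pos⟩
  refine ⟨f.num.natDegree + 1, infVal_lt_of_degree (a := f.num) f.denom_ne_zero
    (mul_denom_eq_num f) ?_⟩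
  · rw [degree_eq_natDegree (RatFunc.num_ne_zero hf), degree_eq_natDegree f.denom_ne_zero]
    have : f.num.natDegree < f.denom.natDegree + (f.num.natDegree + 1) := by omega
    exact_mod_cast this

/-- All coefficients of `P` grow slower than `z^J`. -/
def GrowthLT (J : ℕ) (P : (RatFunc ℂ)[X]) : Prop := ∀ k, infVal (P.coeff k) < WithZero.exp (J : ℤ)

namespace GrowthLT

variable {J : ℕ} {P Q : (RatFunc ℂ)[X]}

theorem zero : GrowthLT J 0 := fun k => by
  rw [coeff_zero, map_zero]; exact WithZero.exp_pos

theorem add (hP : GrowthLT J P) (hQ : GrowthLT J Q) : GrowthLT J (P + Q) := fun k => by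
  rw [coeff_add]; exact infVal.map_add_lt (hP k) (hQ k)

theorem neg (hP : GrowthLT J P) : GrowthLT J (-P) := fun k => by
  rw [coeff_neg, Valuation.map_neg]; exact hP k

theorem sub (hP : GrowthLT J P) (hQ : GrowthLT J Q) : GrowthLT J (P - Q) := by
  rw [sub_eq_add_neg]; exact hP.add hQ.neg

theorem sum {ι : Type*} (s : Finset ι) (F : ι → (RatFunc ℂ)[X])
    (h : ∀ j ∈ s, GrowthLT J (F j)) : GrowthLT J (∑ j ∈ s, F j) :=
  Finset.sum_induction F (GrowthLT J) (fun _ _ => add) zero h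

theorem mono {J' : ℕ} (h : J ≤ J') (hP : GrowthLT J P) : GrowthLT J' P := fun k =>
  (hP k).trans_le (WithZero.exp_le_exp.mpr (by omega))

theorem mul_of_le (hP : GrowthLT J P) (hQ : ∀ k, infVal (Q.coeff k) ≤ 1) :
    GrowthLT J (Q * P) := fun k => by
  rw [coeff_mul]
  refine infVal.map_sum_lt WithZero.exp_ne_zero fun p _ => ?_
  rw [map_mul]
  exact (mul_le_of_le_one_left' (hQ _)).trans_lt (hP _)

theorem map_mul (hP : GrowthLT J P) (c : ℂ[X]) :
    GrowthLT J (c.map (algebraMap ℂ (RatFunc ℂ)) * P) :=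
  hP.mul_of_le fun k => by rw [coeff_map]; exact infVal_const_le _

/-- Only the term z P gains an order of growth; the commutator term differentiates in the symbol
variable, hence multiplies coefficients by integers. -/
theorem mulZ (hP : GrowthLT J P) : GrowthLT (J + 1) (_root_.mulZ P) := fun k => by
  rw [coeff_mulZ]
  refine infVal.map_add_lt ?_ ?_
  · have h1 : infVal ((k : RatFunc ℂ) + 1) ≤ 1 := by
      simpa using infVal_const_le ((k : ℂ) + 1)
    rw [_root_.map_mul]
    exact (mul_le_of_le_one_right' h1).trans_lt (hP.mono (Nat.le_succ J) _)
  · rw [_root_.map_mul, infVal_X, Nat.cast_succ, add_comm, WithZero.exp_add]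
    exact mul_lt_mul_of_pos_left (hP k) WithZero.exp_pos

end GrowthLT

theorem exists_growthLT {r : ℕ} (V : Fin r → (RatFunc ℂ)[X]) : ∃ J, ∀ i, GrowthLT J (V i) := by
  choose f hf using fun (p : Fin r × ℕ) => exists_infVal_lt ((V p.1).coeff p.2)
  have key : ∀ i, ∃ J, GrowthLT J (V i) := fun i => by
    refine ⟨∑ k ∈ (V i).support, f (i, k), fun k => ?_⟩
    by_cases hk : k ∈ (V i).support
    · refine (hf (i, k)).trans_le (WithZero.exp_le_exp.mpr ?_)
      exact_mod_cast Finset.single_le_sum (f := fun k => f (i, k)) (fun _ _ => Nat.zero_le _) hk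
    · rw [notMem_support_iff.mp hk, map_zero]; exact WithZero.exp_pos
  choose J hJ using key
  exact ⟨∑ i, J i, fun i => (hJ i).mono
    (Finset.single_le_sum (f := J) (fun _ _ => Nat.zero_le _) (Finset.mem_univ i))⟩

/-- The part of order `z^J` of a symbol, in which only terms growing slower than `z^(J+1)`
occur. -/
theorem GrowthLT.exists_leading {J m : ℕ} {P : (RatFunc ℂ)[X]} (hP : GrowthLT (J + 1) P)
    (hm : ∀ k, m < k → P.coeff k = 0) :
    ∃ c : ℂ[X], (∀ k, m < k → c.coeff k = 0) ∧
      GrowthLT J (P - c.map (algebraMap ℂ (RatFunc ℂ)) * C (RatFunc.X ^ J)) := by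
  choose f hf using fun k => exists_infVal_sub_lt (hP k)
  have hc : ∀ k, (∑ j ∈ Finset.range (m + 1), monomial j (f j)).coeff k =
      if k < m + 1 then f k else 0 := fun k => by
    simp [finsetSum_coeff, coeff_monomial]
  refine ⟨∑ j ∈ Finset.range (m + 1), monomial j (f j), fun k hk => ?_, fun k => ?_⟩
  · rw [hc, if_neg (by omega)]
  · rw [coeff_sub, coeff_mul_C, coeff_map, hc]
    split_ifs with h
    · exact hf k
    · rw [hm k (by omega), map_zero, zero_mul, sub_zero, map_zero]; exact WithZero.exp_pos

/-! ### The leading coefficients, given a system of operators of Baker type -/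

/-- A system of operators `S i = τ(∂) e_i + (lower order, vanishing at infinity)` that map
`ℂ[z]` into `W`. -/
structure BakerSystem {r : ℕ} (W : Submodule ℂ (RatVec r)) (n : ℕ) (τ : ℂ[X])
    (S : Fin r → Fin r → (RatFunc ℂ)[X]) : Prop where
  mapsInto : ∀ i, MapsInto W (S i)
  monic : τ.Monic
  natDegree : τ.natDegree = n
  growth : ∀ i l, GrowthLT 0
    (S i l - if i = l then τ.map (algebraMap ℂ (RatFunc ℂ)) else 0)
  coeff_eq : ∀ i l k, n ≤ k →
    (S i l).coeff k = (if i = l then τ.map (algebraMap ℂ (RatFunc ℂ)) else 0).coeff k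

namespace BakerSystem

variable {r n : ℕ} {W : Submodule ℂ (RatVec r)} {τ : ℂ[X]} {S : Fin r → Fin r → (RatFunc ℂ)[X]}

theorem coeff_tau_top (h : BakerSystem W n τ S) :
    (τ.map (algebraMap ℂ (RatFunc ℂ))).coeff n = 1 := by
  rw [coeff_map, ← h.natDegree, h.monic.coeff_natDegree, map_one]

theorem coeff_tau (h : BakerSystem W n τ S) (k : ℕ) (hk : n < k) :
    (τ.map (algebraMap ℂ (RatFunc ℂ))).coeff k = 0 := by
  rw [coeff_map, coeff_eq_zero_of_natDegree_lt (by rw [h.natDegree]; exact hk), map_zero]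

theorem coeff_top (h : BakerSystem W n τ S) (i l : Fin r) :
    (S i l).coeff n = if i = l then 1 else 0 := by
  rw [h.coeff_eq i l n le_rfl]
  split_ifs
  · exact h.coeff_tau_top
  · rfl

theorem coeff_high (h : BakerSystem W n τ S) (i l : Fin r) (k : ℕ) (hk : n < k) :
    (S i l).coeff k = 0 := by
  rw [h.coeff_eq i l k hk.le]
  split_ifs
  · exact h.coeff_tau k hk
  · rfl

theorem iterate_coeff (h : BakerSystem W n τ S) (J : ℕ) (i l : Fin r) :
    (∀ k, n < k → (mulZ^[J] (S i l)).coeff k = 0) ∧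
      (mulZ^[J] (S i l)).coeff n = if i = l then RatFunc.X ^ J else 0 := by
  induction J with
  | zero => exact ⟨h.coeff_high i l, by simpa using h.coeff_top i l⟩
  | succ J ih =>
    rw [Function.iterate_succ_apply']
    refine ⟨fun k hk => ?_, ?_⟩
    · rw [coeff_mulZ, ih.1 k hk, ih.1 (k + 1) (by omega)]; simp
    -- The coefficient in degree n + 1 vanishes, so the one in degree n is just multiplied by z.
    · rw [coeff_mulZ, ih.1 (n + 1) (by omega), ih.2]
      split_ifs <;> ring

/-- At infinity S_i ∘ z^J behaves like τ(∂) z^J e_i. Passing from J to J + 1 produces the extra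
commutator term τ' z^J, which is o(z^(J+1)) and is absorbed by `h2`. -/
theorem iterate_growth (h : BakerSystem W n τ S) (J : ℕ) (i l : Fin r) :
    GrowthLT J (mulZ^[J] (S i l) -
      (if i = l then τ.map (algebraMap ℂ (RatFunc ℂ)) else 0) * C (RatFunc.X ^ J)) := by
  induction J with
  | zero => simpa using h.growth i l
  | succ J ih =>
    rw [Function.iterate_succ_apply']
    have h1 := ih.mulZ
    have h2 : GrowthLT (J + 1) (derivative
        (if i = l then τ.map (algebraMap ℂ (RatFunc ℂ)) else 0) * C (RatFunc.X ^ J)) := by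
      split_ifs
      · rw [derivative_map]
        refine GrowthLT.map_mul (fun k => ?_) _
        rw [coeff_C]
        split_ifs
        · rw [map_pow, infVal_X, ← WithZero.exp_nsmul, WithZero.exp_lt_exp]; simp
        · rw [map_zero]; exact WithZero.exp_pos
      · simpa using GrowthLT.zero
    convert h1.add h2 using 1
    simp only [mulZ, derivative_sub, derivative_mul, derivative_C, pow_succ, C_mul]
    ring

/-- The operators that map `ℂ[z]` into `W` have polynomial leading coefficients, if none of them
vanishes at infinity. -/
theorem coeff_mem_range (h : BakerSystem W n τ S)
    (hinj : ∀ V, MapsInto W V → (∀ i, GrowthLT 0 (V i)) → V = 0) (J : ℕ) :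
    ∀ (m : ℕ) (V : Fin r → (RatFunc ℂ)[X]), MapsInto W V → (∀ i, GrowthLT J (V i)) →
      (∀ i k, m < k → (V i).coeff k = 0) →
      ∀ i, ∃ g : ℂ[X], algebraMap ℂ[X] (RatFunc ℂ) g = (V i).coeff m := by
  induction J with
  | zero =>
    intro m V hV hg _ i
    -- Coefficients vanishing at infinity force V = 0.
    exact ⟨0, by rw [hinj V hV hg]; simp⟩
  | succ J ih =>
    intro m V hV hg hm i
    choose c hc hc' using fun l => (hg l).exists_leading (hm l)
    set T := τ.map (algebraMap ℂ (RatFunc ℂ)) with hT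
    -- The factor τ on V matches the leading part τ z^J of the symbol of S_j ∘ z^J, so the terms of
    -- order z^J cancel. Symbol products with constant coefficient polynomials are right
    -- compositions, so W is respected.
    have hV' : MapsInto W ((fun l => T * V l) + fun l => -(∑ j, (c j).map
        (algebraMap ℂ (RatFunc ℂ)) * mulZ^[J] (S j l))) :=
      (hV.map_mul τ).add (MapsInto.neg (MapsInto.sum _ _ fun j _ =>
        ((h.mapsInto j).iterate_mulZ J).map_mul (c j)))
    have htop : ∀ (A B : (RatFunc ℂ)[X]) (a b : ℕ), (∀ k, a < k → A.coeff k = 0) →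
        (∀ k, b < k → B.coeff k = 0) → (∀ k, a + b < k → (A * B).coeff k = 0) ∧
          (A * B).coeff (a + b) = A.coeff a * B.coeff b := fun A B a b hA hB => by
      have hA' := natDegree_le_iff_coeff_eq_zero.mpr hA
      have hB' := natDegree_le_iff_coeff_eq_zero.mpr hB
      exact ⟨fun k hk => coeff_eq_zero_of_natDegree_lt
        ((natDegree_mul_le_of_le hA' hB').trans_lt hk), coeff_mul_add_eq_of_natDegree_le hA' hB'⟩
    have hcm : ∀ j k, m < k → ((c j).map (algebraMap ℂ (RatFunc ℂ))).coeff k = 0 :=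
      fun j k hk => by rw [coeff_map, hc j k hk, map_zero]
    have hA := fun l => htop T (V l) n m (h.coeff_tau) (hm l)
    have hB := fun j l => htop ((c j).map (algebraMap ℂ (RatFunc ℂ))) (mulZ^[J] (S j l)) m n
      (hcm j) (h.iterate_coeff J j l).1
    have key := ih (n + m) _ hV' ?_ ?_
    · obtain ⟨g, hg'⟩ := key i
      -- In degree n + m, τ V contributes the coefficient m of V because τ is monic of degree n.
      -- Among the S_j ∘ z^J only j = i has a nonzero i-th entry in degree n, namely z^J.
      refine ⟨g + C ((c i).coeff m) * X ^ J, ?_⟩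
      rw [map_add, hg']
      simp only [Pi.add_apply, coeff_add, coeff_neg, finsetSum_coeff, (hA i).2]
      rw [hT, h.coeff_tau_top, one_mul]
      rw [add_comm n m]
      simp only [(hB _ i).2, (h.iterate_coeff J _ i).2, coeff_map, mul_ite, mul_zero,
        Finset.sum_ite_eq', Finset.mem_univ, if_true, map_mul, map_pow, RatFunc.algebraMap_X,
        RatFunc.algebraMap_C]
      simp
    · intro l
      have e1 := (hc' l).map_mul τ
      have e2 := GrowthLT.sum Finset.univ _ fun j _ => (h.iterate_growth J j l).map_mul (c j)
      convert e1.sub e2 using 1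
      simp only [Pi.add_apply, mul_sub, Finset.sum_sub_distrib, ite_mul, zero_mul, mul_ite,
        mul_zero, Finset.sum_ite_eq', Finset.mem_univ, if_true, ← hT]
      ring
    · intro l k hk
      simp only [Pi.add_apply, coeff_add, coeff_neg, finsetSum_coeff, (hA l).1 k hk]
      rw [Finset.sum_eq_zero fun j _ => (hB j l).1 k (by omega)]
      simp

/-- The symbol of an operator. -/
def _root_.VecDiffOp.symbol {r : ℕ} (D : VecDiffOp r) (i : Fin r) : (RatFunc ℂ)[X] :=
  D.sum fun k d => monomial k (d i)

theorem _root_.VecDiffOp.coeff_symbol {r : ℕ} (D : VecDiffOp r) (i : Fin r) (k : ℕ) :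
    (D.symbol i).coeff k = D k i := by
  rw [VecDiffOp.symbol, Finsupp.sum, finsetSum_coeff]
  simp only [coeff_monomial, Finset.sum_ite_eq', Finsupp.mem_support_iff]
  split_ifs with h
  · rfl
  · rw [Finsupp.notMem_support_iff.mp h]; rfl

theorem _root_.VecDiffOp.opAct_symbol {r : ℕ} (D : VecDiffOp r) (i : Fin r) (p : ℂ[X]) :
    opAct (D.symbol i) p = D.act p i := by
  have : ∀ (s : Finset ℕ) (F : ℕ → (RatFunc ℂ)[X]),
      opAct (∑ k ∈ s, F k) p = ∑ k ∈ s, opAct (F k) p := fun s F =>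
    map_sum (⟨⟨fun P => opAct P p, opAct_zero p⟩, fun P Q => opAct_add P Q p⟩ :
      (RatFunc ℂ)[X] →+ RatFunc ℂ) F s
  rw [VecDiffOp.symbol, VecDiffOp.act, Finsupp.sum, this, Finsupp.sum, Finset.sum_apply]
  exact Finset.sum_congr rfl fun k _ => opAct_monomial _ _ _

theorem _root_.VecDiffOp.exists_symbol {r : ℕ} (V : Fin r → (RatFunc ℂ)[X]) :
    ∃ D : VecDiffOp r, D.symbol = V := by
  refine ⟨Finsupp.onFinset (Finset.univ.biUnion fun i => (V i).support)
    (fun k i => (V i).coeff k) fun k hk => ?_, ?_⟩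
  · obtain ⟨i, hi⟩ := Function.ne_iff.mp hk
    exact Finset.mem_biUnion.mpr ⟨i, Finset.mem_univ i, mem_support_iff.mpr hi⟩
  · ext i k : 2
    rw [VecDiffOp.coeff_symbol]; rfl

theorem _root_.mem_baseLattice {r : ℕ} {f : RatVec r} :
    f ∈ baseLattice r ↔ ∀ i, ∃ g : ℂ[X], algebraMap ℂ[X] (RatFunc ℂ) g = f i := by
  simp [baseLattice, Submodule.mem_pi]

theorem _root_.VecDiffOp.leadingCoeff_eq {r : ℕ} (D : VecDiffOp r) (m : ℕ)
    (hm : ∀ k, m < k → D k = 0) (h : D m ≠ 0) : D.leadingCoeff = D m := by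
  have : D.support.sup id = m := le_antisymm
    (Finset.sup_le fun k hk => not_lt.mp fun hlt => Finsupp.mem_support_iff.mp hk (hm k hlt))
    (Finset.le_sup (f := id) (Finsupp.mem_support_iff.mpr h))
  rw [VecDiffOp.leadingCoeff, this]

/-- The lattice of leading coefficients of `W` is the base lattice. -/
theorem leadingLattice_eq (h : BakerSystem W n τ S)
    (hinj : ∀ V, MapsInto W V → (∀ i, GrowthLT 0 (V i)) → V = 0) :
    leadingLattice W = (baseLattice r : Set (RatVec r)) := by
  ext f
  refine ⟨?_, fun hf => ?_⟩
  · rintro ⟨D, hD, rfl⟩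
    obtain ⟨J, hJ⟩ := exists_growthLT D.symbol
    refine mem_baseLattice.mpr fun i => ?_
    have key := h.coeff_mem_range hinj J (D.support.sup id) D.symbol ?_ hJ ?_
    · obtain ⟨g, hg⟩ := key i
      exact ⟨g, by rw [hg, VecDiffOp.coeff_symbol]; rfl⟩
    · intro p
      simp only [VecDiffOp.opAct_symbol]
      exact hD p
    · intro l k hk
      rw [VecDiffOp.coeff_symbol]
      have : D k = 0 := by
        by_contra hne
        exact absurd (Finset.le_sup (f := id) (Finsupp.mem_support_iff.mpr hne)) (not_le.mpr hk)
      rw [this]; rfl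
  -- The zero vector is treated apart: `leadingCoeff_eq` needs the coefficient in degree n to be
  -- nonzero.
  · by_cases hf0 : f = 0
    · refine ⟨0, fun p => ?_, by rw [hf0]; rfl⟩
      simp [VecDiffOp.act]
    choose g hg using mem_baseLattice.mp hf
    choose Q hQ hQ' hQ'' using fun i =>
      (h.mapsInto i).exists_comp_mul (fun l => h.coeff_high i l) (g i)
    obtain ⟨D, hD⟩ := VecDiffOp.exists_symbol fun l => ∑ j, Q j l
    have hDc : ∀ k l, D k l = ∑ j, (Q j l).coeff k := fun k l => by
      rw [← VecDiffOp.coeff_symbol, hD, finsetSum_coeff]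
    have hDn : D n = f := by
      ext l : 1
      rw [hDc]
      simp [hQ'', h.coeff_top, hg]
    refine ⟨D, fun p => ?_, ?_⟩
    · have := MapsInto.sum Finset.univ Q (fun j _ => hQ j) p
      rw [← hD] at this
      simpa only [VecDiffOp.opAct_symbol] using this
    · rw [D.leadingCoeff_eq n (fun k hk => ?_) (by rwa [hDn]), hDn]
      ext l : 1
      rw [hDc]
      exact Finset.sum_eq_zero fun j _ => hQ' j l k hk

end BakerSystem

/-! ### Rational functions on a circle -/

/-- The coordinate function on the circle of radius `R`. -/
def circleCoord (R : ℝ) : C(UnitAddCircle, ℂ) := (R : ℂ) • fourier 1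

theorem circleCoord_apply (R : ℝ) (t : UnitAddCircle) : circleCoord R t = circlePoint R t := by
  simp [circleCoord, circlePoint]

theorem norm_circlePoint {R : ℝ} (hR : 0 < R) (t : UnitAddCircle) : ‖circlePoint R t‖ = R := by
  rw [circlePoint, norm_mul, Circle.norm_coe, Complex.norm_real, Real.norm_of_nonneg hR.le,
    mul_one]

theorem aeval_circleCoord_apply (R : ℝ) (p : ℂ[X]) (t : UnitAddCircle) :
    aeval (circleCoord R) p t = p.eval (circlePoint R t) := by
  induction p using Polynomial.induction_on' with
  | add p q hp hq => rw [map_add, ContinuousMap.add_apply, hp, hq, eval_add]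
  | monomial n a => simp [aeval_monomial, circleCoord_apply, Algebra.algebraMap_eq_smul_one]

/-- The polynomial `b` has no roots outside the open disc of radius `R`. -/
def NoRoots (R : ℝ) (b : ℂ[X]) : Prop := ∀ z : ℂ, R ≤ ‖z‖ → b.eval z ≠ 0

theorem NoRoots.mul {R : ℝ} {a b : ℂ[X]} (ha : NoRoots R a) (hb : NoRoots R b) :
    NoRoots R (a * b) := fun z hz => by
  rw [eval_mul]; exact mul_ne_zero (ha z hz) (hb z hz)

theorem NoRoots.of_dvd {R : ℝ} {a b : ℂ[X]} (hb : NoRoots R b) (h : a ∣ b) : NoRoots R a := by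
  rintro z hz h0
  obtain ⟨c, rfl⟩ := h
  exact hb z hz (by rw [eval_mul, h0, zero_mul])

theorem NoRoots.ne_zero {R : ℝ} {b : ℂ[X]} (hb : NoRoots R b) : b ≠ 0 := by
  rintro rfl
  exact hb (R : ℂ) (by simpa using le_abs_self R) eval_zero

theorem NoRoots.isUnit {R : ℝ} (hR : 0 < R) {b : ℂ[X]} (hb : NoRoots R b) :
    IsUnit (aeval (circleCoord R) b) := by
  rw [ContinuousMap.isUnit_iff_forall_ne_zero]
  intro t
  rw [aeval_circleCoord_apply]
  exact hb _ (norm_circlePoint hR t).ge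

theorem eventually_noRoots {b : ℂ[X]} (hb : b ≠ 0) : ∀ᶠ R in atTop, NoRoots R b := by
  have : ∀ᶠ R : ℝ in atTop, ∀ z ∈ b.roots.toFinset, ‖z‖ < R :=
    (Filter.eventually_all_finset _).mpr fun z _ => eventually_gt_atTop _
  filter_upwards [this] with R hR z hz h0
  exact absurd (hR z (by simpa [hb] using h0)) (not_lt.mpr hz)

/-- The rational function `f` has no poles outside the open disc of radius `R`. -/
def RegularOutside (R : ℝ) (f : RatFunc ℂ) : Prop := NoRoots R f.denom

namespace RegularOutside

variable {R : ℝ} {f g : RatFunc ℂ}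

theorem add (hf : RegularOutside R f) (hg : RegularOutside R g) : RegularOutside R (f + g) :=
  (NoRoots.mul hf hg).of_dvd (RatFunc.denom_add_dvd f g)

theorem mul (hf : RegularOutside R f) (hg : RegularOutside R g) : RegularOutside R (f * g) :=
  (NoRoots.mul hf hg).of_dvd (RatFunc.denom_mul_dvd f g)

theorem polynomial (p : ℂ[X]) : RegularOutside R (algebraMap ℂ[X] (RatFunc ℂ) p) := fun z _ => by
  simp

theorem of_mul_eq {a b : ℂ[X]} (hb : NoRoots R b)
    (h : f * algebraMap ℂ[X] (RatFunc ℂ) b = algebraMap ℂ[X] (RatFunc ℂ) a) :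
    RegularOutside R f :=
  hb.of_dvd ((RatFunc.denom_dvd hb.ne_zero).mpr
    ⟨a, by rw [← h, mul_div_cancel_right₀]; simpa using hb.ne_zero⟩)

theorem zero : RegularOutside R 0 := by simpa using polynomial (R := R) 0

theorem const (a : ℂ) : RegularOutside R (algebraMap ℂ (RatFunc ℂ) a) := by
  simpa using polynomial (R := R) (C a)

theorem sum {ι : Type*} (s : Finset ι) (F : ι → RatFunc ℂ)
    (h : ∀ j ∈ s, RegularOutside R (F j)) : RegularOutside R (∑ j ∈ s, F j) :=
  Finset.sum_induction F (RegularOutside R) (fun _ _ => add) zero h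

end RegularOutside

theorem eventually_regularOutside (f : RatFunc ℂ) : ∀ᶠ R in atTop, RegularOutside R f :=
  eventually_noRoots f.denom_ne_zero

/-- The restriction of a rational function to the circle of radius `R`. -/
def circleVal (R : ℝ) (f : RatFunc ℂ) : C(UnitAddCircle, ℂ) :=
  aeval (circleCoord R) f.num * Ring.inverse (aeval (circleCoord R) f.denom)

section circleVal

variable {R : ℝ} {f g : RatFunc ℂ}

theorem circleVal_mul_denom (hR : 0 < R) (hf : RegularOutside R f) :
    circleVal R f * aeval (circleCoord R) f.denom = aeval (circleCoord R) f.num := by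
  rw [circleVal, mul_assoc, Ring.inverse_mul_cancel _ (NoRoots.isUnit hR hf), mul_one]

/-- Any fraction representing f may replace the reduced one, even if b has zeros on the circle:
cross-multiply, then cancel the denominator of f, which is a unit there. -/
theorem circleVal_mul_eq (hR : 0 < R) (hf : RegularOutside R f) {a b : ℂ[X]}
    (h : f * algebraMap ℂ[X] (RatFunc ℂ) b = algebraMap ℂ[X] (RatFunc ℂ) a) :
    circleVal R f * aeval (circleCoord R) b = aeval (circleCoord R) a := by
  have hp : f.num * b = a * f.denom := by
    apply RatFunc.algebraMap_injective ℂ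
    rw [map_mul, map_mul, ← h, ← mul_denom_eq_num]
    ring
  apply (NoRoots.isUnit hR hf).mul_right_cancel
  rw [mul_right_comm, circleVal_mul_denom hR hf, ← map_mul, hp, map_mul]

theorem circleVal_eq (hR : 0 < R) {a b : ℂ[X]} (hb : NoRoots R b)
    (h : f * algebraMap ℂ[X] (RatFunc ℂ) b = algebraMap ℂ[X] (RatFunc ℂ) a)
    {u : C(UnitAddCircle, ℂ)} (hu : u * aeval (circleCoord R) b = aeval (circleCoord R) a) :
    circleVal R f = u := by
  apply (hb.isUnit hR).mul_right_cancel
  rw [hu, circleVal_mul_eq hR (.of_mul_eq hb h) h]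

theorem circleVal_add (hR : 0 < R) (hf : RegularOutside R f) (hg : RegularOutside R g) :
    circleVal R (f + g) = circleVal R f + circleVal R g := by
  refine circleVal_eq (a := f.num * g.denom + g.num * f.denom) hR (NoRoots.mul hf hg) ?_ ?_
  · simp only [map_mul, map_add, ← mul_denom_eq_num]
    ring
  · simp only [map_mul, map_add, ← circleVal_mul_denom hR hf, ← circleVal_mul_denom hR hg]
    ring

theorem circleVal_mul (hR : 0 < R) (hf : RegularOutside R f) (hg : RegularOutside R g) :
    circleVal R (f * g) = circleVal R f * circleVal R g := by
  refine circleVal_eq (a := f.num * g.num) hR (NoRoots.mul hf hg) ?_ ?_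
  · simp only [map_mul, ← mul_denom_eq_num]
    ring
  · simp only [map_mul, ← circleVal_mul_denom hR hf, ← circleVal_mul_denom hR hg]
    ring

theorem circleVal_algebraMap (p : ℂ[X]) :
    circleVal R (algebraMap ℂ[X] (RatFunc ℂ) p) = aeval (circleCoord R) p := by
  simp [circleVal]

theorem circleVal_const (a : ℂ) :
    circleVal R (algebraMap ℂ (RatFunc ℂ) a) = algebraMap ℂ C(UnitAddCircle, ℂ) a := by
  simpa using circleVal_algebraMap (R := R) (C a)

theorem circleVal_zero : circleVal R 0 = 0 := by simpa using circleVal_algebraMap (R := R) 0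

theorem circleVal_sum (hR : 0 < R) {ι : Type*} (s : Finset ι) (F : ι → RatFunc ℂ)
    (h : ∀ j ∈ s, RegularOutside R (F j)) :
    circleVal R (∑ j ∈ s, F j) = ∑ j ∈ s, circleVal R (F j) := by
  classical
  induction s using Finset.induction_on with
  | empty => simp [circleVal_zero]
  | insert a s ha ih =>
    rw [Finset.sum_insert ha, Finset.sum_insert ha, circleVal_add hR (h a (by simp))
      (.sum _ _ fun j hj => h j (by simp [hj])), ih fun j hj => h j (by simp [hj])]

theorem circleVal_apply (hR : 0 < R) (hf : RegularOutside R f) (t : UnitAddCircle) :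
    circleVal R f t = f.eval (RingHom.id ℂ) (circlePoint R t) := by
  have h := congrArg (fun u : C(UnitAddCircle, ℂ) => u t) (circleVal_mul_denom hR hf)
  simp only [ContinuousMap.mul_apply, aeval_circleCoord_apply] at h
  have h0 := hf (circlePoint R t) (norm_circlePoint hR t).ge
  rw [RatFunc.eval, eval₂_id, eval₂_id, ← h, mul_div_cancel_right₀ _ h0]

end circleVal

/-! ### Fourier coefficients of rational functions -/

theorem norm_fourierCoeff_le (φ : C(UnitAddCircle, ℂ)) (k : ℤ) : ‖fourierCoeff φ k‖ ≤ ‖φ‖ := by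
  rw [fourierCoeff]
  refine (norm_integral_le_of_norm_le_const (C := ‖φ‖) (.of_forall fun t => ?_)).trans ?_
  · rw [norm_smul]
    have : ‖fourier (-k) t‖ = 1 := by rw [fourier_apply, Circle.norm_coe]
    rw [this, one_mul]
    exact φ.norm_coe_le_norm t
  · simp

theorem fourierCoeff_add' (φ ψ : C(UnitAddCircle, ℂ)) (k : ℤ) :
    fourierCoeff ⇑(φ + ψ) k = fourierCoeff φ k + fourierCoeff ψ k :=
  congrFun (fourierCoeff.add (φ.continuous.integrable_of_hasCompactSupport
    (HasCompactSupport.of_compactSpace _)) (ψ.continuous.integrable_of_hasCompactSupport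
    (HasCompactSupport.of_compactSpace _))) k

theorem fourierCoeff_smul' (c : ℂ) (φ : C(UnitAddCircle, ℂ)) (k : ℤ) :
    fourierCoeff ⇑(c • φ) k = c * fourierCoeff φ k :=
  fourierCoeff.const_smul φ c k

theorem fourierCoeff_sub' (φ ψ : C(UnitAddCircle, ℂ)) (k : ℤ) :
    fourierCoeff ⇑(φ - ψ) k = fourierCoeff φ k - fourierCoeff ψ k := by
  have : φ - ψ = φ + (-1 : ℂ) • ψ := by
    ext t; simp [sub_eq_add_neg]
  rw [this, fourierCoeff_add', fourierCoeff_smul']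
  ring

theorem fourierCoeff_circleCoord_mul (R : ℝ) (φ : C(UnitAddCircle, ℂ)) (k : ℤ) :
    fourierCoeff ⇑(circleCoord R * φ) k = R * fourierCoeff φ (k - 1) := by
  rw [circleCoord, smul_mul_assoc, fourierCoeff_smul', fourierCoeff, fourierCoeff]
  congr 1
  refine integral_congr_ae (.of_forall fun t => ?_)
  simp only [smul_eq_mul, ContinuousMap.mul_apply]
  rw [← mul_assoc, ← fourier_add]
  congr 3
  ring

theorem fourierCoeff_aeval (R : ℝ) (p : ℂ[X]) (k : ℤ) :
    fourierCoeff ⇑(aeval (circleCoord R) p) k =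
      if 0 ≤ k then p.coeff k.toNat * (R : ℂ) ^ k.toNat else 0 := by
  induction p using Polynomial.induction_on' with
  | add p q hp hq =>
    rw [map_add, fourierCoeff_add', hp, hq, coeff_add]
    split_ifs <;> ring
  | monomial n a =>
    have h1 : (circleCoord R) ^ n = ((R : ℂ) ^ n) • fourier (n : ℤ) := by
      ext t
      simp only [circleCoord, ContinuousMap.pow_apply, ContinuousMap.smul_apply, smul_eq_mul, mul_pow,
        fourier_apply, one_smul, natCast_zsmul, AddCircle.toCircle_nsmul, Circle.coe_pow]
    rw [aeval_monomial, h1, ← Algebra.smul_def, fourierCoeff_smul', fourierCoeff_smul',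
      fourierCoeff_fourier, coeff_monomial]
    rcases le_or_gt 0 k with hk | hk
    · lift k to ℕ using hk
      by_cases h : n = k
      · subst h; simp
      · have h' : (k : ℤ) ≠ n := fun e => h (by exact_mod_cast e.symm)
        simp [h, h']
    · have h' : k ≠ (n : ℤ) := by omega
      simp [hk.not_ge, h']

theorem aeval_circleCoord_injective {R : ℝ} (hR : 0 < R) {p : ℂ[X]}
    (h : aeval (circleCoord R) p = 0) : p = 0 := by
  ext k
  have h1 := fourierCoeff_aeval R p k
  rw [h] at h1
  have h2 : fourierCoeff ⇑(0 : C(UnitAddCircle, ℂ)) k = 0 := by simp [fourierCoeff]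
  rw [h2] at h1
  have hR' : (R : ℂ) ≠ 0 := by exact_mod_cast hR.ne'
  simpa [hR'] using h1.symm

theorem circleVal_injective {R : ℝ} (hR : 0 < R) {f : RatFunc ℂ} (hf : RegularOutside R f)
    (h : circleVal R f = 0) : f = 0 := by
  have := circleVal_mul_denom hR hf
  rw [h, zero_mul] at this
  rw [← RatFunc.num_eq_zero_iff]
  exact aeval_circleCoord_injective hR this.symm

/-- Dividing by `z - a` lowers the order of growth at infinity. -/
theorem fourierCoeff_eq_zero_of_mul_sub {R : ℝ} {a : ℂ} (ha : ‖a‖ < R)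
    {φ ψ : C(UnitAddCircle, ℂ)} (h : ψ * (circleCoord R - algebraMap ℂ _ a) = φ) {m : ℤ}
    (hφ : ∀ k, m + 1 ≤ k → fourierCoeff φ k = 0) : ∀ k, m ≤ k → fourierCoeff ψ k = 0 := by
  have hR : 0 < R := (norm_nonneg a).trans_lt ha
  have hR' : (R : ℂ) ≠ 0 := by exact_mod_cast hR.ne'
  -- Coefficient k + 1 of (z − a)ψ = φ. Iterating gives |ψ_k| ≤ |a/R|^j ‖ψ‖ for all j, which tends
  -- to 0 as |a| < R.
  have rec1 : ∀ k, m ≤ k → fourierCoeff ψ k = (a / R) * fourierCoeff ψ (k + 1) := fun k hk => by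
    have e : φ = circleCoord R * ψ - a • ψ := by
      rw [← h, Algebra.algebraMap_eq_smul_one, mul_sub, mul_smul_comm, mul_one, mul_comm]
    have h0 := hφ (k + 1) (by omega)
    rw [e, fourierCoeff_sub', fourierCoeff_circleCoord_mul, fourierCoeff_smul',
      add_sub_cancel_right] at h0
    field_simp
    linear_combination h0
  have rec2 : ∀ (j : ℕ) k, m ≤ k →
      fourierCoeff ψ k = (a / R) ^ j * fourierCoeff ψ (k + j) := fun j => by
    induction j with
    | zero => intro k _; simp
    | succ j ih =>
      intro k hk
      rw [ih k hk, rec1 (k + j) (by omega), pow_succ, Nat.cast_succ, mul_assoc, add_assoc]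
  intro k hk
  have hq : ‖a / R‖ < 1 := by
    rw [norm_div, Complex.norm_real, Real.norm_of_nonneg hR.le, div_lt_one hR]; exact ha
  have hlim : Tendsto (fun j : ℕ => ‖a / R‖ ^ j * ‖ψ‖) atTop (nhds 0) := by
    simpa using (tendsto_pow_atTop_nhds_zero_of_lt_one (norm_nonneg _) hq).mul_const ‖ψ‖
  rw [← norm_le_zero_iff]
  refine ge_of_tendsto' hlim fun j => ?_
  rw [rec2 j k hk, norm_mul, norm_pow]
  gcongr
  exact norm_fourierCoeff_le ψ _

/-- The roots of b all lie inside the circle and are divided out one at a time, each lowering the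
bound on the exponents by one. -/
theorem fourierCoeff_eq_zero_of_mul_aeval {R : ℝ} (d : ℕ) : ∀ {b : ℂ[X]}, NoRoots R b →
    b.natDegree = d → ∀ {φ ψ : C(UnitAddCircle, ℂ)}, ψ * aeval (circleCoord R) b = φ → ∀ {m : ℤ},
    (∀ k, m + d ≤ k → fourierCoeff φ k = 0) → ∀ k, m ≤ k → fourierCoeff ψ k = 0 := by
  induction d with
  | zero =>
    intro b hb hd φ ψ h m hφ k hk
    obtain ⟨c, rfl⟩ := natDegree_eq_zero.mp hd
    have hc : c ≠ 0 := fun h0 => hb.ne_zero (by rw [h0, C_0])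
    rw [aeval_C, mul_comm, ← Algebra.smul_def] at h
    have h1 := hφ k (by simpa using hk)
    rw [← h, fourierCoeff_smul'] at h1
    exact (mul_eq_zero.mp h1).resolve_left hc
  | succ d ih =>
    intro b hb hd φ ψ h m hφ
    obtain ⟨a, ha⟩ := Complex.exists_root (f := b)
      (by rw [degree_eq_natDegree hb.ne_zero, hd]; exact_mod_cast Nat.succ_pos d)
    obtain ⟨b', rfl⟩ := dvd_iff_isRoot.mpr ha
    have haR : ‖a‖ < R := not_le.mp fun hle => hb a hle ha
    have hb' : NoRoots R b' := hb.of_dvd (dvd_mul_left _ _)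
    have hd' : b'.natDegree = d := by
      rw [natDegree_mul (X_sub_C_ne_zero a) hb'.ne_zero, natDegree_X_sub_C] at hd
      omega
    refine ih hb' hd' rfl (fourierCoeff_eq_zero_of_mul_sub haR (φ := φ) ?_ fun k hk =>
      hφ k (by push_cast; omega))
    rw [← h]
    simp only [map_mul, map_sub, aeval_X, aeval_C]
    ring

/-- A rational function that vanishes at infinity has only negative powers of `z`. -/
theorem fourierCoeff_circleVal_eq_zero {R : ℝ} (hR : 0 < R) {f : RatFunc ℂ}
    (hf : RegularOutside R f) (hv : infVal f < WithZero.exp ((0 : ℕ) : ℤ)) (k : ℤ) (hk : 0 ≤ k) :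
    fourierCoeff (circleVal R f) k = 0 := by
  refine fourierCoeff_eq_zero_of_mul_aeval _ hf rfl (circleVal_mul_denom hR hf) (m := 0)
    (fun k hk => ?_) k hk
  rw [fourierCoeff_aeval, if_pos (by omega), coeff_eq_zero_of_degree_lt, zero_mul]
  refine (degree_lt_of_infVal_lt hv).trans_le ?_
  rw [degree_eq_natDegree f.denom_ne_zero, Nat.cast_zero, add_zero]
  exact_mod_cast (by omega : f.denom.natDegree ≤ k.toNat)

theorem eq_zero_of_fourierCoeff_eq_zero {φ : C(UnitAddCircle, ℂ)}
    (h : ∀ k, fourierCoeff φ k = 0) : φ = 0 := by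
  have h0 : fourierCoeff φ = 0 := funext h
  have hs : Summable (fourierCoeff φ) := by rw [h0]; exact summable_zero
  ext t
  have ht := has_pointwise_sum_fourier_series_of_summable hs t
  have e : (fun i : ℤ => fourierCoeff φ i • (fourier i t : ℂ)) = fun _ => 0 :=
    funext fun i => by rw [h i, zero_smul]
  rw [e] at ht
  exact ht.unique hasSum_zero

/-- A rational function without negative powers of `z` is a polynomial. -/
theorem exists_algebraMap_eq_of_fourierCoeff {R : ℝ} (hR : 0 < R) {f : RatFunc ℂ}
    (hf : RegularOutside R f) (h : ∀ k < 0, fourierCoeff (circleVal R f) k = 0) :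
    ∃ g : ℂ[X], algebraMap ℂ[X] (RatFunc ℂ) g = f := by
  -- Split f into its polynomial part q and a proper fraction. The latter has no nonnegative powers
  -- since it vanishes at infinity, and no negative ones by hypothesis, so it is zero.
  set q := f.num /ₘ f.denom
  set s := f.num %ₘ f.denom
  have hqs : s + f.denom * q = f.num := modByMonic_add_div f.num f.denom
  set f' := f + algebraMap ℂ[X] (RatFunc ℂ) (-q) with hf'
  have hr : RegularOutside R f' := hf.add (.polynomial _)
  have hm : f' * algebraMap ℂ[X] (RatFunc ℂ) f.denom = algebraMap ℂ[X] (RatFunc ℂ) s := by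
    rw [hf', add_mul, mul_denom_eq_num, ← hqs]
    simp only [map_add, map_mul, map_neg]
    ring
  have hv : infVal f' < WithZero.exp ((0 : ℕ) : ℤ) :=
    infVal_lt_of_degree f.denom_ne_zero hm
      (by simpa using degree_modByMonic_lt _ f.monic_denom)
  have hval : circleVal R f' = circleVal R f - aeval (circleCoord R) q := by
    rw [hf', circleVal_add hR hf (.polynomial _), circleVal_algebraMap, map_neg, sub_eq_add_neg]
  have h0 : circleVal R f' = 0 := eq_zero_of_fourierCoeff_eq_zero fun k => by
    rcases le_or_gt 0 k with hk | hk
    · exact fourierCoeff_circleVal_eq_zero hR hr hv k hk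
    · rw [hval, fourierCoeff_sub', h k hk, fourierCoeff_aeval, if_neg hk.not_ge, sub_zero]
  have := circleVal_injective hR hr h0
  refine ⟨q, ?_⟩
  rw [hf', map_neg, ← sub_eq_add_neg, sub_eq_zero] at this
  exact this.symm

/-! ### The exponential series -/

/-- The function `exp (x z)` on the circle. -/
def circleExp (R : ℝ) (x : ℂ) : C(UnitAddCircle, ℂ) :=
  ⟨fun t => Complex.exp (x * circleCoord R t), by fun_prop⟩

/-- The exponential series in the Banach algebra of continuous functions; its sum is identified
pointwise. -/
theorem hasSum_circleExp (R : ℝ) (x : ℂ) :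
    HasSum (fun j : ℕ => (x ^ j / (j.factorial : ℂ)) • circleCoord R ^ j) (circleExp R x) := by
  have h := NormedSpace.exp_series_hasSum_exp' (𝕂 := ℂ) (x • circleCoord R)
  have e : NormedSpace.exp (x • circleCoord R) = circleExp R x := by
    ext t
    have h1 := ContinuousMap.hasSum_apply h t
    have h2 := NormedSpace.exp_series_hasSum_exp' (𝕂 := ℂ) (x * circleCoord R t)
    rw [← Complex.exp_eq_exp_ℂ] at h2
    refine h1.unique ?_
    simp only [ContinuousMap.smul_apply, ContinuousMap.pow_apply, smul_eq_mul] at h2 ⊢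
    exact h2
  rw [e] at h
  have e' : (fun j : ℕ => (x ^ j / (j.factorial : ℂ)) • circleCoord R ^ j) =
      fun j => (j.factorial : ℂ)⁻¹ • (x • circleCoord R) ^ j := funext fun j => by
    rw [_root_.smul_pow, smul_smul, div_eq_inv_mul]
  rw [e']
  exact h

theorem hasSum_iterate_derivative (R : ℝ) (x : ℂ) (k : ℕ) :
    HasSum (fun j : ℕ => (x ^ j / (j.factorial : ℂ)) •
      aeval (circleCoord R) (derivative^[k] (X ^ j : ℂ[X]))) (x ^ k • circleExp R x) := by
  have h0 : ∑ j ∈ Finset.range k, (x ^ j / (j.factorial : ℂ)) •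
      aeval (circleCoord R) (derivative^[k] (X ^ j : ℂ[X])) = 0 :=
    Finset.sum_eq_zero fun j hj => by
      rw [iterate_derivative_X_pow_eq_smul,
        Nat.descFactorial_eq_zero_iff_lt.mpr (Finset.mem_range.mp hj)]
      rw [Nat.cast_zero, zero_smul, map_zero]
      ext t
      exact mul_zero (x ^ j / (j.factorial : ℂ))
  -- The terms with j < k vanish; after the shift the factorials cancel and x^k comes out.
  rw [← hasSum_nat_add_iff' k, h0, sub_zero]
  have e : (fun j : ℕ => (x ^ (j + k) / ((j + k).factorial : ℂ)) •
      aeval (circleCoord R) (derivative^[k] (X ^ (j + k) : ℂ[X]))) =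
      fun j => x ^ k • ((x ^ j / (j.factorial : ℂ)) • circleCoord R ^ j) := funext fun j => by
    rw [iterate_derivative_X_pow_eq_smul, Nat.add_sub_cancel, map_smul,
      smul_smul, map_pow, aeval_X, smul_smul]
    congr 1
    have h1 := Nat.factorial_mul_descFactorial (Nat.le_add_left k j)
    rw [Nat.add_sub_cancel] at h1
    have h2 : ((j + k).factorial : ℂ) = j.factorial * ((j + k).descFactorial k : ℂ) := by
      exact_mod_cast h1.symm
    have h3 : (j.factorial : ℂ) ≠ 0 := by exact_mod_cast j.factorial_ne_zero
    have h4 : ((j + k).descFactorial k : ℂ) ≠ 0 := by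
      intro h0
      rw [h0, mul_zero] at h2
      exact (j + k).factorial_ne_zero (by exact_mod_cast h2)
    rw [h2, pow_add]
    field_simp
  rw [e]
  exact (hasSum_circleExp R x).const_smul (x ^ k)

/-- The operator with symbol `P` maps `exp (x z)` to `P(x) exp (x z)`. -/
theorem hasSum_opAct {R : ℝ} (hR : 0 < R) (x : ℂ) {P : (RatFunc ℂ)[X]}
    (hP : ∀ k, RegularOutside R (P.coeff k)) :
    HasSum (fun j : ℕ => (x ^ j / (j.factorial : ℂ)) • circleVal R (opAct P (X ^ j)))
      (circleVal R (P.eval (algebraMap ℂ (RatFunc ℂ) x)) * circleExp R x) := by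
  have h := hasSum_sum (s := P.support) fun k _ =>
    (hasSum_iterate_derivative R x k).mul_left (circleVal R (P.coeff k))
  have e1 : (fun j : ℕ => (x ^ j / (j.factorial : ℂ)) • circleVal R (opAct P (X ^ j))) =
      fun j => ∑ k ∈ P.support, circleVal R (P.coeff k) * ((x ^ j / (j.factorial : ℂ)) •
        aeval (circleCoord R) (derivative^[k] (X ^ j : ℂ[X]))) := funext fun j => by
    rw [opAct, Polynomial.sum, circleVal_sum hR _ _ fun k _ => (hP k).mul (.polynomial _),
      Finset.smul_sum]
    refine Finset.sum_congr rfl fun k _ => ?_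
    rw [circleVal_mul hR (hP k) (.polynomial _), circleVal_algebraMap, mul_smul_comm]
  have e2 : circleVal R (P.eval (algebraMap ℂ (RatFunc ℂ) x)) * circleExp R x =
      ∑ k ∈ P.support, circleVal R (P.coeff k) * (x ^ k • circleExp R x) := by
    rw [eval_eq_sum, Polynomial.sum]
    simp only [← map_pow]
    rw [circleVal_sum hR _ _ fun k _ => (hP k).mul (.const _), Finset.sum_mul]
    refine Finset.sum_congr rfl fun k _ => ?_
    rw [circleVal_mul hR (hP k) (.const _), circleVal_const, mul_assoc, ← Algebra.smul_def]
  rw [e1, e2]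
  exact h

/-! ### Classes of continuous functions in `L²` of the circle -/

/-- A vector of continuous functions as a continuous function with values in `ℂ^r`. -/
def circleVec (r : ℕ) : (Fin r → C(UnitAddCircle, ℂ)) →L[ℂ]
    C(UnitAddCircle, EuclideanSpace ℂ (Fin r)) where
  toFun φ := ⟨fun t => WithLp.toLp 2 fun i => φ i t, by fun_prop⟩
  map_add' _ _ := rfl
  map_smul' _ _ := rfl
  cont := ContinuousMap.continuous_of_continuous_uncurry _ (by
    refine (PiLp.continuous_toLp 2 _).comp (continuous_pi fun i => ?_)
    exact ContinuousEval.continuous_eval.comp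
      (((continuous_apply i).comp continuous_fst).prodMk continuous_snd))

/-- The class in `L²` of a vector of continuous functions. -/
def circleClass (r : ℕ) : (Fin r → C(UnitAddCircle, ℂ)) →L[ℂ] CircleL2 r :=
  (ContinuousMap.toLp (E := EuclideanSpace ℂ (Fin r)) 2
    (AddCircle.haarAddCircle (T := (1 : ℝ))) ℂ).comp (circleVec r)

section circleClass

variable {r : ℕ}

theorem circleClass_ae (φ : Fin r → C(UnitAddCircle, ℂ)) :
    ∀ᵐ t ∂(AddCircle.haarAddCircle (T := (1 : ℝ))),
      circleClass r φ t = WithLp.toLp 2 fun i => φ i t :=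
  ContinuousMap.coeFn_toLp (𝕜 := ℂ) (p := 2) _ (circleVec r φ)

theorem circleClass_eq_iff (φ : Fin r → C(UnitAddCircle, ℂ)) (F : CircleL2 r) :
    F = circleClass r φ ↔ ∀ᵐ t ∂(AddCircle.haarAddCircle (T := (1 : ℝ))),
      F t = WithLp.toLp 2 fun i => φ i t := by
  rw [Lp.ext_iff]
  constructor
  · intro h
    filter_upwards [h, circleClass_ae φ] with t h1 h2
    rw [h1, h2]
  · intro h
    filter_upwards [h, circleClass_ae φ] with t h1 h2
    rw [h1, h2]

theorem circleClass_injective {φ : Fin r → C(UnitAddCircle, ℂ)} (h : circleClass r φ = 0) :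
    φ = 0 := by
  have h1 := circleClass_ae φ
  rw [h] at h1
  funext i
  ext1 t
  revert t
  rw [← funext_iff]
  refine (Continuous.ae_eq_iff_eq (AddCircle.haarAddCircle (T := (1 : ℝ))) (φ i).continuous
    continuous_const).mp ?_
  filter_upwards [h1, Lp.coeFn_zero (EuclideanSpace ℂ (Fin r)) 2
    (AddCircle.haarAddCircle (T := (1 : ℝ)))] with t h2 h3
  rw [h3] at h2
  have := congrArg (fun v : EuclideanSpace ℂ (Fin r) => v i) h2
  have h4 : φ i t = 0 := by simpa using this.symm
  exact h4

theorem integrable_circle {E : Type*} [NormedAddCommGroup E] {f : UnitAddCircle → E}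
    (hf : Continuous f) : Integrable f (AddCircle.haarAddCircle (T := (1 : ℝ))) :=
  hf.integrable_of_hasCompactSupport (HasCompactSupport.of_compactSpace _)

/-- The functional `F ↦ ∫ g F_i` on `L²`. -/
theorem inner_circleClass (i : Fin r) (g : C(UnitAddCircle, ℂ))
    (φ : Fin r → C(UnitAddCircle, ℂ)) :
    inner ℂ (circleClass r (Pi.single i (star g))) (circleClass r φ) =
      ∫ t, g t * φ i t ∂(AddCircle.haarAddCircle (T := (1 : ℝ))) := by
  rw [L2.inner_def]
  refine integral_congr_ae ?_
  filter_upwards [circleClass_ae φ, circleClass_ae (Pi.single i (star g))] with t h1 h2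
  rw [h1, h2, PiLp.inner_apply]
  rw [Finset.sum_eq_single i]
  · simp [mul_comm]
  · intro j _ hj
    simp [Pi.single_eq_of_ne hj]
  · simp

theorem inHMinus_circleClass {φ : Fin r → C(UnitAddCircle, ℂ)}
    (h : ∀ i, ∀ k : ℤ, 0 ≤ k → fourierCoeff (φ i) k = 0) : InHMinus ⇑(circleClass r φ) := by
  intro k hk
  have e : fourierCoeff (⇑(circleClass r φ)) k = fourierCoeff
      (fun t => (WithLp.toLp 2 fun i => φ i t : EuclideanSpace ℂ (Fin r))) k :=
    integral_congr_ae (by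
      filter_upwards [circleClass_ae φ] with t h1
      rw [h1])
  rw [e]
  have hint : Integrable (fun t : UnitAddCircle => fourier (-k) t •
      (WithLp.toLp 2 fun i => φ i t : EuclideanSpace ℂ (Fin r)))
      (AddCircle.haarAddCircle (T := (1 : ℝ))) := integrable_circle (by fun_prop)
  ext i
  have h1 := (EuclideanSpace.proj (𝕜 := ℂ) i).integral_comp_comm hint
  rw [fourierCoeff]
  refine Eq.trans (h1.symm.trans ?_) (h i k hk)
  rfl

theorem mem_translateInv_iff {R : ℝ} {x : ℂ} {S : Set (CircleL2 r)}
    (φ : Fin r → C(UnitAddCircle, ℂ)) :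
    circleClass r φ ∈ translateInv S R (stationaryLoop r x) ↔
      circleClass r (fun i => φ i * circleExp R x) ∈ S := by
  have key : ∀ G : CircleL2 r, (∀ᵐ t ∂(AddCircle.haarAddCircle (T := (1 : ℝ))),
      G t = WithLp.toLp 2 (Matrix.vecMul (WithLp.ofLp (circleClass r φ t))
        (stationaryLoop r x (circlePoint R t)))) ↔
      G = circleClass r (fun i => φ i * circleExp R x) := fun G => by
    rw [circleClass_eq_iff]
    refine eventually_congr ?_
    filter_upwards [circleClass_ae φ] with t ht
    rw [ht]
    have : (Matrix.vecMul (WithLp.ofLp (WithLp.toLp 2 fun i => φ i t))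
        (stationaryLoop r x (circlePoint R t))) = fun i => (φ i * circleExp R x) t := by
      ext i
      simp [stationaryLoop, Matrix.vecMul_smul, circleExp, circleCoord_apply, mul_comm]
    rw [this]
  constructor
  · rintro ⟨G, hG, h⟩
    rwa [(key G).mp h] at hG
  · intro h
    exact ⟨_, h, (key _).mpr rfl⟩

end circleClass

/-! ### The closure of a point of the rational Grassmannian -/

/-- The vector `h / q`. -/
def divVec (r : ℕ) (q : ℂ[X]) : (Fin r → ℂ[X]) →ₗ[ℂ] RatVec r where
  toFun h i := (algebraMap ℂ[X] (RatFunc ℂ) q)⁻¹ * algebraMap ℂ[X] (RatFunc ℂ) (h i)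
  map_add' h k := by
    ext i
    simp [mul_add]
  map_smul' c h := by
    ext i
    have : algebraMap ℂ[X] (RatFunc ℂ) (c • h i) = c • algebraMap ℂ[X] (RatFunc ℂ) (h i) :=
      (Algebra.linearMap ℂ[X] (RatFunc ℂ)).map_smul_of_tower c (h i)
    simp [this]

theorem divVec_apply_mul {r : ℕ} {q : ℂ[X]} (hq : q ≠ 0) (h : Fin r → ℂ[X]) (i : Fin r) :
    divVec r q h i * algebraMap ℂ[X] (RatFunc ℂ) q = algebraMap ℂ[X] (RatFunc ℂ) (h i) := by
  have : algebraMap ℂ[X] (RatFunc ℂ) q ≠ 0 := by simpa using hq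
  simp only [divVec, LinearMap.coe_mk, AddHom.coe_mk]
  field_simp

theorem mem_scaledBase {r : ℕ} {c : RatFunc ℂ} {f : RatVec r} :
    f ∈ scaledBase r c ↔ ∃ h : Fin r → ℂ[X], ∀ i, f i = c * algebraMap ℂ[X] (RatFunc ℂ) (h i) := by
  rw [scaledBase, Submodule.mem_map]
  constructor
  · rintro ⟨g, hg, rfl⟩
    choose h hh using mem_baseLattice.mp hg
    exact ⟨h, fun i => by rw [hh]; rfl⟩
  · rintro ⟨h, hh⟩
    exact ⟨fun i => algebraMap ℂ[X] (RatFunc ℂ) (h i), mem_baseLattice.mpr fun i => ⟨h i, rfl⟩,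
      funext fun i => (hh i).symm⟩

/-- The class of `h / q` in `L²`. -/
def divClass (r : ℕ) (R : ℝ) (q : ℂ[X]) : (Fin r → ℂ[X]) →ₗ[ℂ] CircleL2 r :=
  (circleClass r).toLinearMap ∘ₗ LinearMap.pi fun i =>
    (LinearMap.mulLeft ℂ (Ring.inverse (aeval (circleCoord R) q))) ∘ₗ
      (aeval (circleCoord R)).toLinearMap ∘ₗ LinearMap.proj i

section closure

variable {r : ℕ} {W : Submodule ℂ (RatVec r)} {R : ℝ} {p q : ℂ[X]}

theorem divClass_apply (h : Fin r → ℂ[X]) : divClass r R q h =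
    circleClass r fun i => Ring.inverse (aeval (circleCoord R) q) * aeval (circleCoord R) (h i) :=
  rfl

theorem regularOutside_divVec (hq : NoRoots R q) (h : Fin r → ℂ[X]) (i : Fin r) :
    RegularOutside R (divVec r q h i) :=
  .of_mul_eq hq (divVec_apply_mul hq.ne_zero h i)

theorem circleVal_divVec (hR : 0 < R) (hq : NoRoots R q) (h : Fin r → ℂ[X]) (i : Fin r) :
    circleVal R (divVec r q h i) =
      Ring.inverse (aeval (circleCoord R) q) * aeval (circleCoord R) (h i) := by
  refine circleVal_eq hR hq (divVec_apply_mul hq.ne_zero h i) ?_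
  rw [mul_right_comm, Ring.inverse_mul_cancel _ (hq.isUnit hR), one_mul]

theorem divClass_eq (hR : 0 < R) (hq : NoRoots R q) (h : Fin r → ℂ[X]) :
    divClass r R q h = circleClass r fun i => circleVal R (divVec r q h i) := by
  rw [divClass_apply]
  congr 1
  ext1 i
  rw [circleVal_divVec hR hq]

/-- The closure of `W` on a circle, as a closed subspace. -/
theorem circleClosure_eq (hR : 0 < R) (hq : NoRoots R q)
    (hW : W ≤ scaledBase r (algebraMap ℂ[X] (RatFunc ℂ) q)⁻¹) :
    circleClosure W R =
      (((W.comap (divVec r q)).map (divClass r R q)).topologicalClosure : Set (CircleL2 r)) := by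
  rw [Submodule.topologicalClosure_coe, circleClosure]
  congr 1
  have key : ∀ h, ∀ F : CircleL2 r, (∀ᵐ t ∂(AddCircle.haarAddCircle (T := (1 : ℝ))),
      F t = WithLp.toLp 2 fun i => (divVec r q h i).eval (RingHom.id ℂ) (circlePoint R t)) ↔
      divClass r R q h = F := fun h F => by
    rw [divClass_eq hR hq, eq_comm, circleClass_eq_iff]
    simp only [circleVal_apply hR (regularOutside_divVec hq h _)]
  ext F
  constructor
  · rintro ⟨f, hf, h⟩
    obtain ⟨g, hg⟩ := mem_scaledBase.mp (hW hf)
    have hfg : f = divVec r q g := funext hg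
    subst hfg
    exact ⟨g, hf, (key g F).mp h⟩
  · rintro ⟨g, hg, h⟩
    exact ⟨_, hg, (key g F).mpr h⟩

theorem circleClass_mem_circleClosure (hR : 0 < R) (hq : NoRoots R q)
    (hW : W ≤ scaledBase r (algebraMap ℂ[X] (RatFunc ℂ) q)⁻¹) {f : RatVec r} (hf : f ∈ W) :
    (circleClass r fun i => circleVal R (f i)) ∈ circleClosure W R := by
  obtain ⟨g, hg⟩ := mem_scaledBase.mp (hW hf)
  have hfg : f = divVec r q g := funext hg
  subst hfg
  rw [circleClosure_eq hR hq hW, ← divClass_eq hR hq]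
  exact Submodule.le_topologicalClosure _ ⟨g, hf, rfl⟩

/-- Divide numerators by pq. The multiples of pq, over q, give p ℂ[z]^r ⊆ W, so the remainders also
give elements of W, and they range over a finite-dimensional space. -/
theorem comap_divVec_le (hp : p ≠ 0) (hq : q ≠ 0)
    (hW' : scaledBase r (algebraMap ℂ[X] (RatFunc ℂ) p) ≤ W) :
    W.comap (divVec r q) ≤
      LinearMap.range (LinearMap.pi fun i => LinearMap.mulLeft ℂ (p * q) ∘ₗ
        (LinearMap.proj i : (Fin r → ℂ[X]) →ₗ[ℂ] ℂ[X])) ⊔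
      (LinearMap.range (LinearMap.pi fun i => (degreeLT ℂ (p * q).natDegree).subtype ∘ₗ
        (LinearMap.proj i : (Fin r → degreeLT ℂ (p * q).natDegree) →ₗ[ℂ] _)) ⊓
          W.comap (divVec r q)) := by
  intro h hh
  have hpq : p * q ≠ 0 := mul_ne_zero hp hq
  have hs : ∀ i, h i = p * q * (h i / (p * q)) + h i % (p * q) := fun i =>
    (EuclideanDomain.div_add_mod _ _).symm
  have h1 : divVec r q (fun i => p * q * (h i / (p * q))) ∈ W := hW' (mem_scaledBase.mpr
    ⟨fun i => h i / (p * q), fun i => by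
      have : algebraMap ℂ[X] (RatFunc ℂ) q ≠ 0 := by simpa using hq
      simp only [divVec, LinearMap.coe_mk, AddHom.coe_mk, map_mul]
      field_simp⟩)
  have hsum : h = (fun i => p * q * (h i / (p * q))) + fun i => h i % (p * q) := funext hs
  refine Submodule.mem_sup.mpr ⟨_, ⟨fun i => h i / (p * q), rfl⟩, fun i => h i % (p * q),
    ⟨⟨fun i => ⟨h i % (p * q), ?_⟩, rfl⟩, ?_⟩, hsum.symm⟩
  · rw [mem_degreeLT, ← degree_eq_natDegree hpq]
    exact EuclideanDomain.mod_lt _ hpq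
  · have := W.sub_mem hh h1
    rw [← map_sub] at this
    rw [← eq_sub_of_add_eq' hsum.symm] at this
    exact this

/-- A rational vector in the closure of `W` on a large circle belongs to `W`. -/
theorem mem_of_circleClass_mem (hR : 0 < R) (hp : NoRoots R p) (hq : NoRoots R q)
    (hW' : scaledBase r (algebraMap ℂ[X] (RatFunc ℂ) p) ≤ W)
    (hW : W ≤ scaledBase r (algebraMap ℂ[X] (RatFunc ℂ) q)⁻¹) {f : RatVec r}
    (hf : ∀ i, RegularOutside R (f i))
    (h : (circleClass r fun i => circleVal R (f i)) ∈ circleClosure W R) : f ∈ W := by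
  rw [circleClosure_eq hR hq hW, SetLike.mem_coe] at h
  set A := LinearMap.range (LinearMap.pi fun i => LinearMap.mulLeft ℂ (p * q) ∘ₗ
        (LinearMap.proj i : (Fin r → ℂ[X]) →ₗ[ℂ] ℂ[X])) with hA
  set B := LinearMap.range (LinearMap.pi fun i => (degreeLT ℂ (p * q).natDegree).subtype ∘ₗ
        (LinearMap.proj i : (Fin r → degreeLT ℂ (p * q).natDegree) →ₗ[ℂ] _)) with hB
  have hle := comap_divVec_le hp.ne_zero hq.ne_zero hW'
  have : FiniteDimensional ℂ (degreeLT ℂ (p * q).natDegree) :=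
    (degreeLTEquiv ℂ (p * q).natDegree).symm.finiteDimensional
  have : FiniteDimensional ℂ B := LinearMap.finiteDimensional_range _
  have : FiniteDimensional ℂ ↥(B ⊓ W.comap (divVec r q)) :=
    Submodule.finiteDimensional_inf_left _ _
  -- A closed subspace plus a finite-dimensional one is closed, so taking the closure of W only
  -- enlarges the part p ℂ[z]^r.
  have hcl := Submodule.isClosed_sup_finiteDimensional
    (A.map (divClass r R q)).topologicalClosure
    ((B ⊓ W.comap (divVec r q)).map (divClass r R q)) (Submodule.isClosed_topologicalClosure _)
  have hle' : ((W.comap (divVec r q)).map (divClass r R q)).topologicalClosure ≤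
      (A.map (divClass r R q)).topologicalClosure ⊔
        (B ⊓ W.comap (divVec r q)).map (divClass r R q) := by
    refine Submodule.topologicalClosure_minimal _ ((Submodule.map_mono hle).trans ?_) hcl
    rw [Submodule.map_sup]
    exact sup_le_sup_right (Submodule.le_topologicalClosure _) _
  obtain ⟨u, hu, _, ⟨h0, ⟨_, hh0⟩, rfl⟩, huv⟩ := Submodule.mem_sup.mp (hle' h)
  have hreg : ∀ i, RegularOutside R (f i + -1 * divVec r q h0 i) := fun i =>
    (hf i).add (.mul (by simpa using RegularOutside.const (-1)) (regularOutside_divVec hq h0 i))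
  have hval : u = circleClass r fun i => circleVal R (f i + -1 * divVec r q h0 i) := by
    rw [← sub_eq_of_eq_add huv.symm, divClass_eq hR hq, ← map_sub]
    congr 1
    ext1 i
    have e1 : RegularOutside R (-1) := by simpa using RegularOutside.const (-1)
    have e2 : circleVal R (-1) = -1 := by simpa using circleVal_const (R := R) (-1)
    rw [circleVal_add hR (hf i) (e1.mul (regularOutside_divVec hq h0 i)),
      circleVal_mul hR e1 (regularOutside_divVec hq h0 i), e2]
    ext t
    simp [sub_eq_add_neg]
  -- The negative Fourier coefficients of u / p are continuous in u and vanish on p ℂ[z]^r, hence on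
  -- its closure. So (f − h0/q) / p will be a polynomial vector.
  have hzero : ∀ i : Fin r, ∀ k : ℤ, k < 0 → inner ℂ (circleClass r (Pi.single i (star
      (fourier (-k) * Ring.inverse (aeval (circleCoord R) p))))) u = 0 := fun i k hk => by
    have hc : IsClosed {u : CircleL2 r | inner ℂ (circleClass r (Pi.single i (star
        (fourier (-k) * Ring.inverse (aeval (circleCoord R) p))))) u = 0} :=
      isClosed_eq (by fun_prop) continuous_const
    refine closure_minimal ?_ hc hu
    rintro _ ⟨_, ⟨s, rfl⟩, rfl⟩
    rw [Set.mem_ofPred_eq, divClass_apply, inner_circleClass]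
    have := fourierCoeff_aeval R (s i) k
    rw [if_neg hk.not_ge] at this
    rw [← this, fourierCoeff]
    refine integral_congr_ae (.of_forall fun t => ?_)
    have e1 := congrArg (fun u : C(UnitAddCircle, ℂ) => u t)
      (Ring.inverse_mul_cancel _ (hp.isUnit hR))
    have e2 := congrArg (fun u : C(UnitAddCircle, ℂ) => u t)
      (Ring.inverse_mul_cancel _ (hq.isUnit hR))
    simp only [ContinuousMap.mul_apply, ContinuousMap.one_apply] at e1 e2
    simp only [LinearMap.pi_apply, LinearMap.comp_apply, LinearMap.proj_apply,
      LinearMap.mulLeft_apply, map_mul, ContinuousMap.mul_apply, smul_eq_mul]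
    linear_combination (fourier (-k) t) * (aeval (circleCoord R) (s i) t) *
      (e1 * (Ring.inverse (aeval (circleCoord R) q) t * aeval (circleCoord R) q t) + e2)
  have hpoly : ∀ i, ∃ g : ℂ[X], algebraMap ℂ[X] (RatFunc ℂ) g =
      (f i + -1 * divVec r q h0 i) * (algebraMap ℂ[X] (RatFunc ℂ) p)⁻¹ := fun i => by
    have hp0 : algebraMap ℂ[X] (RatFunc ℂ) p ≠ 0 := by simpa using hp.ne_zero
    have einv : (algebraMap ℂ[X] (RatFunc ℂ) p)⁻¹ * algebraMap ℂ[X] (RatFunc ℂ) p =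
        algebraMap ℂ[X] (RatFunc ℂ) 1 := by rw [inv_mul_cancel₀ hp0, map_one]
    have rinv : RegularOutside R (algebraMap ℂ[X] (RatFunc ℂ) p)⁻¹ := .of_mul_eq hp einv
    have vinv : circleVal R (algebraMap ℂ[X] (RatFunc ℂ) p)⁻¹ =
        Ring.inverse (aeval (circleCoord R) p) :=
      circleVal_eq hR hp einv (by rw [Ring.inverse_mul_cancel _ (hp.isUnit hR), map_one])
    refine exists_algebraMap_eq_of_fourierCoeff hR ((hreg i).mul rinv) fun k hk => ?_
    rw [circleVal_mul hR (hreg i) rinv, vinv, fourierCoeff]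
    have := hzero i k hk
    rw [hval, inner_circleClass] at this
    rw [← this]
    refine integral_congr_ae (.of_forall fun t => ?_)
    simp only [ContinuousMap.mul_apply, smul_eq_mul]
    ring
  choose g hg using hpoly
  have hfin : f - divVec r q h0 ∈ W := hW' (mem_scaledBase.mpr ⟨g, fun i => by
    have hp0 : algebraMap ℂ[X] (RatFunc ℂ) p ≠ 0 := by simpa using hp.ne_zero
    rw [hg, Pi.sub_apply]
    field_simp
    ring⟩)
  simpa using W.add_mem hfin hh0

end closure

/-! ### Operators whose action on exponentials is known -/

/-- An everywhere convergent power series that vanishes on an infinite bounded set is zero. -/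
theorem powerSeries_eq_zero {c : ℕ → ℂ} {F : ℂ → ℂ} (h : ∀ x, HasSum (fun j => c j * x ^ j) (F x))
    {T : Set ℂ} (hT : T.Infinite) {ρ : ℝ} (hb : T ⊆ Metric.closedBall 0 ρ)
    (h0 : ∀ x ∈ T, F x = 0) : c = 0 := by
  have hF : HasFPowerSeriesOnBall F (FormalMultilinearSeries.ofScalars ℂ c) 0 ⊤ :=
    { r_le := by
        rw [FormalMultilinearSeries.radius_eq_top_of_summable_norm]
        intro s
        have := (h (s : ℝ)).summable.norm
        simpa [FormalMultilinearSeries.ofScalars_norm] using this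
      r_pos := ENNReal.zero_lt_top
      hasSum := fun {y} _ => by
        simpa [FormalMultilinearSeries.ofScalars_apply_eq, mul_comm] using h y }
  -- The zeros accumulate, so the entire function F vanishes identically.
  obtain ⟨a, _, ha⟩ := hT.exists_accPt_of_subset_isCompact (isCompact_closedBall 0 ρ) hb
  have han : AnalyticOnNhd ℂ F Set.univ := by
    simpa [Metric.eball_top] using hF.analyticOnNhd
  have hz : Set.EqOn F 0 Set.univ := by
    refine han.eqOn_zero_of_preconnected_of_frequently_eq_zero isPreconnected_univ
      (Set.mem_univ a) ?_
    exact (accPt_iff_frequently_nhdsNE.mp ha).mono fun x hx => h0 x hx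
  have hF0 : F = 0 := funext fun x => hz (Set.mem_univ x)
  rw [hF0] at hF
  exact (FormalMultilinearSeries.ofScalars_series_eq_zero (E := ℂ)).mp
    (HasFPowerSeriesAt.eq_zero hF.hasFPowerSeriesAt)

theorem eventually_regularOutside_coeff (P : (RatFunc ℂ)[X]) :
    ∀ᶠ R in atTop, ∀ k, RegularOutside R (P.coeff k) := by
  have : ∀ᶠ R in atTop, ∀ k ∈ P.support, RegularOutside R (P.coeff k) :=
    (Filter.eventually_all_finset _).mpr fun k _ => eventually_regularOutside _
  filter_upwards [this] with R hR k
  by_cases hk : k ∈ P.support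
  · exact hR k hk
  · rw [notMem_support_iff.mp hk]; exact .zero

theorem regularOutside_eval {R : ℝ} {P : (RatFunc ℂ)[X]}
    (hP : ∀ k, RegularOutside R (P.coeff k)) (x : ℂ) :
    RegularOutside R (P.eval (algebraMap ℂ (RatFunc ℂ) x)) := by
  rw [eval_eq_sum, Polynomial.sum]
  simp only [← map_pow]
  exact .sum _ _ fun k _ => (hP k).mul (.const _)

theorem regularOutside_opAct {R : ℝ} {P : (RatFunc ℂ)[X]}
    (hP : ∀ k, RegularOutside R (P.coeff k)) (p : ℂ[X]) : RegularOutside R (opAct P p) := by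
  rw [opAct, Polynomial.sum]
  exact .sum _ _ fun k _ => (hP k).mul (.polynomial _)

theorem GrowthLT.eval_lt {J : ℕ} {P : (RatFunc ℂ)[X]} (hP : GrowthLT J P) (x : ℂ) :
    infVal (P.eval (algebraMap ℂ (RatFunc ℂ) x)) < WithZero.exp (J : ℤ) := by
  rw [eval_eq_sum, Polynomial.sum]
  refine infVal.map_sum_lt WithZero.exp_ne_zero fun k _ => ?_
  rw [← _root_.map_pow, _root_.map_mul]
  exact (mul_le_of_le_one_right' (infVal_const_le _)).trans_lt (hP k)

theorem opAct_add_right (P : (RatFunc ℂ)[X]) (p p' : ℂ[X]) :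
    opAct P (p + p') = opAct P p + opAct P p' := by
  simp only [opAct, Polynomial.sum, iterate_map_add, map_add, mul_add, Finset.sum_add_distrib]

theorem opAct_C_mul_right (P : (RatFunc ℂ)[X]) (a : ℂ) (p : ℂ[X]) :
    opAct P (C a * p) = a • opAct P p := by
  simp only [opAct, Polynomial.sum, iterate_derivative_C_mul, map_mul, Algebra.smul_def,
    RatFunc.algebraMap_C, RatFunc.algebraMap_eq_C, Finset.mul_sum]
  exact Finset.sum_congr rfl fun k _ => by ring

/-- The vector form of the expansion of `P(x) exp (x z)` in powers of `x`. -/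
theorem hasSum_circleClass {r : ℕ} {R : ℝ} (hR : 0 < R) (x : ℂ) {P : Fin r → (RatFunc ℂ)[X]}
    (hP : ∀ i k, RegularOutside R ((P i).coeff k)) :
    HasSum (fun j : ℕ => (x ^ j / (j.factorial : ℂ)) •
        circleClass r fun i => circleVal R (opAct (P i) (X ^ j)))
      (circleClass r fun i =>
        circleVal R ((P i).eval (algebraMap ℂ (RatFunc ℂ) x)) * circleExp R x) := by
  have h : HasSum (fun j : ℕ => fun i : Fin r => (x ^ j / (j.factorial : ℂ)) •
      circleVal R (opAct (P i) (X ^ j))) (fun i : Fin r =>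
        circleVal R ((P i).eval (algebraMap ℂ (RatFunc ℂ) x)) * circleExp R x) :=
    Pi.hasSum.mpr fun i => hasSum_opAct hR x (hP i)
  have h' := h.mapL (circleClass r)
  have e : (fun j : ℕ => (x ^ j / (j.factorial : ℂ)) •
        circleClass r fun i => circleVal R (opAct (P i) (X ^ j))) =
      fun j => circleClass r fun i : Fin r => (x ^ j / (j.factorial : ℂ)) •
      circleVal R (opAct (P i) (X ^ j)) := funext fun j =>
    ((circleClass r).map_smul _ _).symm
  rw [e]
  exact h'

section mapsInto

variable {r : ℕ} {W : Submodule ℂ (RatVec r)} {p q : ℂ[X]}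

/-- P(x) e^{xz} is the limit of combinations of the vectors P.z^j, all of which lie in W. -/
theorem MapsInto.mem_circleClosure {R : ℝ} (hR : 0 < R) (hq : NoRoots R q)
    (hW : W ≤ scaledBase r (algebraMap ℂ[X] (RatFunc ℂ) q)⁻¹) {P : Fin r → (RatFunc ℂ)[X]}
    (hP : MapsInto W P) (hreg : ∀ i k, RegularOutside R ((P i).coeff k)) (x : ℂ) :
    (circleClass r fun i => circleVal R ((P i).eval (algebraMap ℂ (RatFunc ℂ) x)) *
      circleExp R x) ∈ circleClosure W R := by
  have hcl : IsClosed (circleClosure W R) := isClosed_closure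
  refine hcl.mem_of_tendsto (hasSum_circleClass hR x hreg) (.of_forall fun s => ?_)
  have := fun j : ℕ => circleClass_mem_circleClosure hR hq hW (hP (X ^ j))
  rw [circleClosure_eq hR hq hW] at this ⊢
  exact Submodule.sum_mem _ fun j _ => Submodule.smul_mem _ _ (this j)

/-- If `P(x) exp (x z)` lies in the closure of `W` for almost all `x`, then the operator with
symbol `P` maps `ℂ[z]` into `W`. -/
theorem mapsInto_of_eventually_mem (hp : p ≠ 0) (hq : q ≠ 0)
    (hW' : scaledBase r (algebraMap ℂ[X] (RatFunc ℂ) p) ≤ W)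
    (hW : W ≤ scaledBase r (algebraMap ℂ[X] (RatFunc ℂ) q)⁻¹) {P : Fin r → (RatFunc ℂ)[X]}
    {τ : ℂ[X]} (hτ : τ ≠ 0) (h : ∀ x, τ.eval x ≠ 0 → ∀ᶠ R in atTop,
      (circleClass r fun i => circleVal R ((P i).eval (algebraMap ℂ (RatFunc ℂ) x)) *
        circleExp R x) ∈ circleClosure W R) : MapsInto W P := by
  -- How large R must be depends on x, whereas the identity theorem needs one circle for infinitely
  -- many x. The sets T N cover the unit disc up to the roots of τ, so by uncountability one of them
  -- is infinite.
  set T : ℕ → Set ℂ := fun N => {x | x ∈ Metric.closedBall (0 : ℂ) 1 ∧ ∀ R : ℝ, N ≤ R →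
    (circleClass r fun i => circleVal R ((P i).eval (algebraMap ℂ (RatFunc ℂ) x)) *
      circleExp R x) ∈ circleClosure W R} with hTdef
  obtain ⟨N, hN⟩ : ∃ N, (T N).Infinite := by
    by_contra! hcon
    have hcount : ((⋃ N, T N) ∪ (τ.roots.toFinset : Set ℂ)).Countable :=
      (Set.countable_iUnion fun N => (hcon N).countable).union
        (Finset.countable_toSet _)
    obtain ⟨x, hx, hx'⟩ := (hcount.dense_compl ℂ).inter_open_nonempty (Metric.ball 0 1)
      Metric.isOpen_ball ⟨0, by simp⟩
    refine hx' ?_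
    by_cases h0 : τ.eval x = 0
    · exact Or.inr (by simpa [hτ] using h0)
    · obtain ⟨R₀, hR₀⟩ := eventually_atTop.mp (h x h0)
      obtain ⟨N, hN⟩ := exists_nat_ge R₀
      exact Or.inl (Set.mem_iUnion.mpr ⟨N, Metric.ball_subset_closedBall hx,
        fun R hR => hR₀ R (hN.trans hR)⟩)
  have hmono : ∀ j : ℕ, (fun i => opAct (P i) (X ^ j)) ∈ W := fun j => by
    obtain ⟨R, hNR, hR, hRp, hRq, hreg⟩ := ((eventually_ge_atTop (N : ℝ)).and
      ((eventually_gt_atTop (0 : ℝ)).and ((eventually_noRoots hp).and ((eventually_noRoots hq).and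
        (eventually_all.mpr fun i => eventually_regularOutside_coeff (P i)))))).exists
    refine mem_of_circleClass_mem hR hRp hRq hW' hW
      (fun i => regularOutside_opAct (hreg i) _) ?_
    -- Pairing with u ⊥ W turns membership in the closure into the vanishing of a scalar power
    -- series in x, whose j-th coefficient is ⟨u, P.z^j⟩ / j!.
    rw [circleClosure_eq hR hRq hW, SetLike.mem_coe, ← Submodule.orthogonal_orthogonal_eq_closure,
      Submodule.mem_orthogonal]
    intro u hu
    have hsum : ∀ x : ℂ, HasSum (fun j : ℕ => (inner ℂ u (circleClass r fun i =>
        circleVal R (opAct (P i) (X ^ j))) / (j.factorial : ℂ)) * x ^ j)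
        (inner ℂ u (circleClass r fun i =>
          circleVal R ((P i).eval (algebraMap ℂ (RatFunc ℂ) x)) * circleExp R x)) := fun x => by
      have := (hasSum_circleClass hR x hreg).mapL (innerSL ℂ u)
      simp only [innerSL_apply_apply, inner_smul_right] at this
      refine this.congr_fun fun j => ?_
      ring
    have hc := powerSeries_eq_zero hsum hN (fun x hx => hx.1) fun x hx => by
      have hmem := hx.2 R hNR
      rw [circleClosure_eq hR hRq hW, SetLike.mem_coe] at hmem
      rw [← Submodule.orthogonal_closure] at hu
      exact Submodule.inner_left_of_mem_orthogonal hmem hu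
    have hcj := congrFun hc j
    exact (div_eq_zero_iff.mp hcj).resolve_right (by exact_mod_cast j.factorial_ne_zero)
  intro s
  induction s using Polynomial.induction_on' with
  | add s s' hs hs' =>
    have := W.add_mem hs hs'
    simp only [opAct_add_right]
    exact this
  | monomial j a =>
    have := W.smul_mem a (hmono j)
    simp only [← C_mul_X_pow_eq_monomial, opAct_C_mul_right]
    exact this

/-- No nonzero operator with coefficients vanishing at infinity maps `ℂ[z]` into `W`, if the
stationary flow through `W` meets the big cell. -/
theorem eq_zero_of_mapsInto (hq : q ≠ 0)
    (hW : W ≤ scaledBase r (algebraMap ℂ[X] (RatFunc ℂ) q)⁻¹) {τ : ℂ[X]} (hτ : τ ≠ 0)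
    (hcell : ∀ x, τ.eval x ≠ 0 → ∀ᶠ R in atTop,
      InBigCell (translateInv (circleClosure W R) R (stationaryLoop r x)))
    (V : Fin r → (RatFunc ℂ)[X]) (hV : MapsInto W V) (hg : ∀ i, GrowthLT 0 (V i)) : V = 0 := by
  have key : ∀ x, τ.eval x ≠ 0 → ∀ i, (V i).eval (algebraMap ℂ (RatFunc ℂ) x) = 0 := fun x hx => by
    obtain ⟨R, hcR, hR, hRq, hreg⟩ := ((hcell x hx).and ((eventually_gt_atTop (0 : ℝ)).and
      ((eventually_noRoots hq).and
        (eventually_all.mpr fun i => eventually_regularOutside_coeff (V i))))).exists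
    have hmem := (mem_translateInv_iff _).mpr (hV.mem_circleClosure hR hRq hW hreg x)
    have hzero : (0 : CircleL2 r) ∈
        translateInv (circleClosure W R) R (stationaryLoop r x) := by
      rw [← map_zero (circleClass r), mem_translateInv_iff, circleClosure_eq hR hRq hW]
      simp only [Pi.zero_apply, zero_mul]
      exact (map_zero (circleClass r)).symm ▸ Submodule.zero_mem _
    have hz : circleClass r 0 = 0 := map_zero _
    have h0 : InHMinus ⇑(0 : CircleL2 r) := by
      rw [← hz]
      exact inHMinus_circleClass fun i k _ => by simp [fourierCoeff]
    have h0' : InHPlus ⇑(0 : CircleL2 r) := fun k _ => by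
      rw [fourierCoeff_congr_ae (Lp.coeFn_zero _ _ _)]
      simp [fourierCoeff]
    obtain ⟨F, _, hF⟩ := hcR 0 h0'
    -- V(x, z) and 0 both lie in the translate of the closure of W and project to 0 in H₊, hence
    -- coincide.
    have e1 := hF _ ⟨hmem, by
      rw [sub_zero]
      exact inHMinus_circleClass fun i k hk => fourierCoeff_circleVal_eq_zero hR
        (regularOutside_eval (hreg i) x) ((hg i).eval_lt x) k hk⟩
    have e2 := hF 0 ⟨hzero, by rwa [sub_zero]⟩
    have e3 := circleClass_injective (e1.trans e2.symm)
    exact fun i => circleVal_injective hR (regularOutside_eval (hreg i) x) (congrFun e3 i)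
  funext i
  refine eq_zero_of_infinite_isRoot _ ?_
  have hinf : {x : ℂ | τ.eval x ≠ 0}.Infinite := by
    have : {x : ℂ | τ.eval x ≠ 0} = (τ.roots.toFinset : Set ℂ)ᶜ := by
      ext x; simp [hτ]
    rw [this]
    exact (Finset.finite_toSet _).infinite_compl
  refine (hinf.image ((algebraMap ℂ (RatFunc ℂ)).injective.injOn)).mono ?_
  rintro _ ⟨x, hx, rfl⟩
  exact key x hx i

end mapsInto

/-! ### The operators attached to a point of the Calogero-Moser space -/

section charmatrix

variable {n : ℕ} (M : Matrix (Fin n) (Fin n) ℂ)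

/-- In (X − M) adj(X − M) = χ_M I the right side has no coefficient in degree k + 1 > n, so
coefficient k of the adjugate is M times coefficient k + 1. Descend from a degree beyond which all
entries vanish.

Applied to −X it bounds the order of the correction terms in the Baker symbols; applied to Y it
makes them vanish at infinity. -/
theorem coeff_adjugate_charmatrix (i j : Fin n) (k : ℕ) (hk : n ≤ k) :
    (M.charmatrix.adjugate i j).coeff k = 0 := by
  have hrec : ∀ i j k, n ≤ k → (M.charmatrix.adjugate i j).coeff k =
      ∑ l, M i l * (M.charmatrix.adjugate l j).coeff (k + 1) := fun i j k hk => by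
    have h1 : (M.charmatrix * M.charmatrix.adjugate) i j =
        (M.charpoly • (1 : Matrix (Fin n) (Fin n) ℂ[X])) i j := by
      rw [Matrix.mul_adjugate]; rfl
    have h2 : (M.charmatrix * M.charmatrix.adjugate) i j = X * M.charmatrix.adjugate i j -
        ∑ l, C (M i l) * M.charmatrix.adjugate l j := by
      conv_lhs => rw [Matrix.charmatrix, Matrix.sub_mul]
      simp only [Matrix.sub_apply, Matrix.scalar_apply, Matrix.diagonal_mul]
      rfl
    have h3 : ((M.charpoly • (1 : Matrix (Fin n) (Fin n) ℂ[X])) i j).coeff (k + 1) = 0 := by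
      rw [Matrix.smul_apply, smul_eq_mul, Matrix.one_apply, mul_ite, mul_one, mul_zero]
      split_ifs
      · exact coeff_eq_zero_of_natDegree_lt (by
          rw [Matrix.charpoly_natDegree_eq_dim, Fintype.card_fin]; omega)
      · rfl
    rw [← h1, h2, coeff_sub, coeff_X_mul, finsetSum_coeff, sub_eq_zero] at h3
    simpa only [coeff_C_mul] using h3
  obtain ⟨B, hB⟩ : ∃ B, ∀ i j k, B ≤ k → (M.charmatrix.adjugate i j).coeff k = 0 := by
    refine ⟨∑ i, ∑ j, ((M.charmatrix.adjugate i j).natDegree + 1), fun i j k hk => ?_⟩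
    refine coeff_eq_zero_of_natDegree_lt (lt_of_lt_of_le ?_ hk)
    refine (Nat.lt_succ_self _).trans_le (le_trans (Finset.single_le_sum
      (f := fun j => (M.charmatrix.adjugate i j).natDegree + 1) (fun _ _ => Nat.zero_le _)
        (Finset.mem_univ j)) (Finset.single_le_sum
      (f := fun i => ∑ j, ((M.charmatrix.adjugate i j).natDegree + 1)) (fun _ _ => Nat.zero_le _)
        (Finset.mem_univ i)))
  have hdesc : ∀ d k, n ≤ k → B ≤ k + d → ∀ i j, (M.charmatrix.adjugate i j).coeff k = 0 := by
    intro d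
    induction d with
    | zero => exact fun k _ hBk i j => hB i j k hBk
    | succ d ih =>
      intro k hnk hBk i j
      rw [hrec i j k hnk]
      exact Finset.sum_eq_zero fun l _ => by
        rw [ih (k + 1) (by omega) (by omega) l j, mul_zero]
  exact hdesc B k hk (by omega) i j

theorem det_smul_one_sub (x : ℂ) : (x • (1 : Matrix (Fin n) (Fin n) ℂ) - M).det =
    M.charpoly.eval x := by
  rw [Matrix.eval_charpoly, Matrix.scalar_apply, Matrix.smul_one_eq_diagonal]

theorem inv_smul_one_sub {x : ℂ} (hx : M.charpoly.eval x ≠ 0) :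
    M.charpoly.eval x • (x • (1 : Matrix (Fin n) (Fin n) ℂ) - M)⁻¹ =
      M.charmatrix.adjugate.map (eval x) := by
  have h1 : (evalRingHom x).mapMatrix M.charmatrix = x • (1 : Matrix (Fin n) (Fin n) ℂ) - M := by
    ext i j
    by_cases h : i = j
    · subst h; simp
    · simp [h, Matrix.charmatrix_apply_ne]
  have h2 := (evalRingHom x).map_adjugate M.charmatrix
  rw [h1] at h2
  rw [Matrix.inv_def, det_smul_one_sub, smul_smul, Ring.mul_inverse_cancel _ hx.isUnit, one_smul,
    ← h2]
  rfl

end charmatrix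

namespace CMQuadruple

variable {n r : ℕ} (c : CMQuadruple n r)

/-- The numerators of the entries of `(z I - Y)⁻¹ v`. -/
def resolventNum : Matrix (Fin n) (Fin r) ℂ[X] := c.Y.charmatrix.adjugate * c.v.map C

/-- The symbols `det (x I + X) (I + w (x I + X)⁻¹ (z I - Y)⁻¹ v)`. -/
def bakerSymbol (i l : Fin r) : (RatFunc ℂ)[X] :=
  (if i = l then (-c.X).charpoly.map (algebraMap ℂ (RatFunc ℂ)) else 0) +
    ∑ a, ∑ b, (C (c.w i a) * (-c.X).charmatrix.adjugate a b).map (algebraMap ℂ (RatFunc ℂ)) *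
      C (algebraMap ℂ[X] (RatFunc ℂ) (c.resolventNum b l) /
        algebraMap ℂ[X] (RatFunc ℂ) c.Y.charpoly)

theorem poleDet_eq (x : ℂ) : c.poleDet x = (-c.X).charpoly.eval x := by
  rw [← det_smul_one_sub, poleDet, sub_neg_eq_add]

theorem coeff_bakerSymbol (i l : Fin r) (k : ℕ) (hk : n ≤ k) : (c.bakerSymbol i l).coeff k =
    (if i = l then (-c.X).charpoly.map (algebraMap ℂ (RatFunc ℂ)) else 0).coeff k := by
  rw [bakerSymbol, coeff_add, finsetSum_coeff, Finset.sum_eq_zero, add_zero]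
  intro a _
  rw [finsetSum_coeff]
  refine Finset.sum_eq_zero fun b _ => ?_
  rw [coeff_mul_C, coeff_map, coeff_C_mul, coeff_adjugate_charmatrix _ a b k hk]
  simp

theorem growth_bakerSymbol (i l : Fin r) : GrowthLT 0 (c.bakerSymbol i l -
    if i = l then (-c.X).charpoly.map (algebraMap ℂ (RatFunc ℂ)) else 0) := by
  rw [bakerSymbol, add_sub_cancel_left]
  refine GrowthLT.sum _ _ fun a _ => GrowthLT.sum _ _ fun b _ => GrowthLT.map_mul (fun k => ?_) _
  rw [coeff_C]
  have hY : c.Y.charpoly ≠ 0 := c.Y.charpoly_monic.ne_zero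
  split_ifs
  · refine infVal_lt_of_degree (a := c.resolventNum b l) hY (div_mul_cancel₀ _ (by simpa using hY))
      ?_
    rw [degree_eq_natDegree hY, Matrix.charpoly_natDegree_eq_dim, Fintype.card_fin, Nat.cast_zero,
      add_zero, degree_lt_iff_coeff_zero]
    intro m hm
    rw [resolventNum, Matrix.mul_apply, finsetSum_coeff]
    refine Finset.sum_eq_zero fun d _ => ?_
    rw [Matrix.map_apply, coeff_mul_C, coeff_adjugate_charmatrix _ b d m hm, zero_mul]
  · rw [map_zero]; exact WithZero.exp_pos

/-- Both resolvents are adjugates divided by characteristic polynomials; the one in x is cleared by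
the factor det(xI + X), the one in z stays in the coefficients. -/
theorem circleVal_bakerSymbol {R : ℝ} (hR : 0 < R) (hY : NoRoots R c.Y.charpoly) {x : ℂ}
    (hx : c.poleDet x ≠ 0) (i l : Fin r) (t : UnitAddCircle) :
    circleVal R ((c.bakerSymbol i l).eval (algebraMap ℂ (RatFunc ℂ) x)) t =
      c.poleDet x * c.bakerFormula x (circlePoint R t) i l := by
  set z := circlePoint R t with hz
  have hχ : c.Y.charpoly.eval z ≠ 0 := hY z (norm_circlePoint hR t).ge
  have hY0 : algebraMap ℂ[X] (RatFunc ℂ) c.Y.charpoly ≠ 0 := by simpa using hY.ne_zero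
  have hmul : (c.bakerSymbol i l).eval (algebraMap ℂ (RatFunc ℂ) x) *
      algebraMap ℂ[X] (RatFunc ℂ) c.Y.charpoly = algebraMap ℂ[X] (RatFunc ℂ)
        (C (if i = l then c.poleDet x else 0) * c.Y.charpoly + ∑ a, ∑ b,
          C (c.w i a * ((-c.X).charmatrix.adjugate a b).eval x) * c.resolventNum b l) := by
    have hC : ∀ a : ℂ, algebraMap ℂ[X] (RatFunc ℂ) (C a) = algebraMap ℂ (RatFunc ℂ) a :=
      fun a => RatFunc.algebraMap_C a
    have hE : ∀ p : ℂ[X], eval (algebraMap ℂ (RatFunc ℂ) x) (p.map (algebraMap ℂ (RatFunc ℂ))) =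
        algebraMap ℂ (RatFunc ℂ) (p.eval x) := fun p => by
      rw [eval_map, eval₂_at_apply]
    rw [bakerSymbol, eval_add, add_mul, map_add, map_mul, hC]
    congr 1
    · split_ifs
      · rw [hE, poleDet_eq]
      · simp
    · rw [eval_finsetSum, Finset.sum_mul, map_sum]
      refine Finset.sum_congr rfl fun a _ => ?_
      rw [eval_finsetSum, Finset.sum_mul, map_sum]
      refine Finset.sum_congr rfl fun b _ => ?_
      rw [eval_mul, hE, eval_C, eval_mul, eval_C, mul_assoc, div_mul_cancel₀ _ hY0, map_mul, map_mul,
        hC, map_mul]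
  have hval := congrArg (fun u : C(UnitAddCircle, ℂ) => u t)
    (circleVal_mul_eq hR (.of_mul_eq hY hmul) hmul)
  simp only [ContinuousMap.mul_apply, aeval_circleCoord_apply, ← hz] at hval
  apply mul_right_cancel₀ hχ
  rw [hval]
  have hA := inv_smul_one_sub (-c.X) (x := x) (by rwa [← poleDet_eq])
  rw [← poleDet_eq, sub_neg_eq_add] at hA
  have hB := inv_smul_one_sub c.Y hχ
  have hnum : ∀ b, (c.resolventNum b l).eval z =
      c.Y.charpoly.eval z * ((z • (1 : Matrix (Fin n) (Fin n) ℂ) - c.Y)⁻¹ * c.v) b l := fun b => by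
    rw [← smul_eq_mul, ← Matrix.smul_apply, ← Matrix.smul_mul, hB, resolventNum, Matrix.mul_apply,
      Matrix.mul_apply, eval_finsetSum]
    simp
  have hadj : ∀ a b, ((-c.X).charmatrix.adjugate a b).eval x =
      c.poleDet x * (x • (1 : Matrix (Fin n) (Fin n) ℂ) + c.X)⁻¹ a b := fun a b => by
    rw [← smul_eq_mul, ← Matrix.smul_apply, hA]
    rfl
  have hform : c.bakerFormula x z i l = (if i = l then 1 else 0) + ∑ a, ∑ b, c.w i a *
      (x • (1 : Matrix (Fin n) (Fin n) ℂ) + c.X)⁻¹ a b *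
        ((z • (1 : Matrix (Fin n) (Fin n) ℂ) - c.Y)⁻¹ * c.v) b l := by
    rw [bakerFormula, Matrix.add_apply, Matrix.one_apply, Matrix.mul_assoc, Matrix.mul_apply,
      Finset.sum_comm]
    simp only [Matrix.mul_apply (M := c.w), Finset.sum_mul]
  rw [hform, eval_add, eval_mul, eval_C, eval_finsetSum, mul_add, add_mul, Finset.mul_sum,
    Finset.sum_mul]
  congr 1
  · split_ifs <;> ring
  · refine Finset.sum_congr rfl fun a _ => ?_
    rw [eval_finsetSum, Finset.mul_sum, Finset.sum_mul]
    refine Finset.sum_congr rfl fun b _ => ?_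
    rw [eval_mul, eval_C, hnum, hadj]
    ring

theorem mem_circleClosure_of_isReducedBakerAt {W : Submodule ℂ (RatVec r)} {q : ℂ[X]} (hq : q ≠ 0)
    (hW : W ≤ scaledBase r (algebraMap ℂ[X] (RatFunc ℂ) q)⁻¹) {x : ℂ} (hx : c.poleDet x ≠ 0)
    (h : IsReducedBakerAt W (stationaryLoop r x) (c.bakerFormula x)) (i : Fin r) :
    ∀ᶠ R in atTop, (circleClass r fun l =>
      circleVal R ((c.bakerSymbol i l).eval (algebraMap ℂ (RatFunc ℂ) x)) * circleExp R x) ∈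
        circleClosure W R := by
  filter_upwards [h, eventually_gt_atTop (0 : ℝ), eventually_noRoots hq,
    eventually_noRoots c.Y.charpoly_monic.ne_zero] with R hB hR hRq hRY
  obtain ⟨F, hF, hFt, -⟩ := hB.2 i
  have hFc : F = circleClass r fun l => (c.poleDet x)⁻¹ •
      circleVal R ((c.bakerSymbol i l).eval (algebraMap ℂ (RatFunc ℂ) x)) := by
    rw [circleClass_eq_iff]
    filter_upwards [hFt] with t ht
    rw [ht]
    congr 1
    ext l
    rw [ContinuousMap.smul_apply, c.circleVal_bakerSymbol hR hRY hx, smul_eq_mul,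
      inv_mul_cancel_left₀ hx]
  rw [hFc, mem_translateInv_iff, circleClosure_eq hR hRq hW] at hF
  have := Submodule.smul_mem _ (c.poleDet x) hF
  rw [← map_smul] at this
  rw [circleClosure_eq hR hRq hW]
  have e : (fun l => circleVal R ((c.bakerSymbol i l).eval (algebraMap ℂ (RatFunc ℂ) x)) *
      circleExp R x) = c.poleDet x • fun l => (c.poleDet x)⁻¹ •
        circleVal R ((c.bakerSymbol i l).eval (algebraMap ℂ (RatFunc ℂ) x)) * circleExp R x := by
    ext1 l
    rw [Pi.smul_apply, smul_mul_assoc, smul_smul, mul_inv_cancel₀ hx, one_smul]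
  rw [e]
  exact this

end CMQuadruple

end

/-- If `W` lies in the image of the Calogero-Moser spaces under `β`, then its lattice `L_W` of
leading coefficients is the base lattice `ℂ[z]^r`. -/
theorem mainTheorem1 (r : ℕ) (W : Submodule ℂ (RatVec r)) (hW : W ∈ betaImage r) :
    leadingLattice W = (baseLattice r : Set (RatVec r)) := by
  obtain ⟨n, c, ⟨p, q, hp, hq, hpW, hWq, -⟩, hβ⟩ := hW
  induction c using Quotient.inductionOn with
  | h c =>
  have hβ' : ∀ x : ℂ, c.poleDet x ≠ 0 →
      IsReducedBakerAt W (stationaryLoop r x) (c.bakerFormula x) := hβ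
  have hτ := (-c.X).charpoly_monic
  have hS : BakerSystem W n (-c.X).charpoly c.bakerSymbol :=
    { mapsInto := fun i => mapsInto_of_eventually_mem hp hq hpW hWq hτ.ne_zero fun x hx => by
        rw [← c.poleDet_eq] at hx
        exact c.mem_circleClosure_of_isReducedBakerAt hq hWq hx (hβ' x hx) i
      monic := hτ
      natDegree := by rw [Matrix.charpoly_natDegree_eq_dim, Fintype.card_fin]
      growth := c.growth_bakerSymbol
      coeff_eq := c.coeff_bakerSymbol }
  refine hS.leadingLattice_eq (eq_zero_of_mapsInto hq hWq hτ.ne_zero fun x hx => ?_)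
  rw [← c.poleDet_eq] at hx
  -- The big cell half of the Baker condition; the half about the rows has produced the operators of
  -- `hS`.
  exact (hβ' x hx).mono fun R hR => hR.1
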